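/- A \emph{walk on the slit plane} of length $n$ is a sequence $w=(w_0,w_1,\dots,w_n)$ of points of $\mathbb{Z}^2$ with $w_0=(0,0)$, $w_m-w_{m-1}\in\{(\pm1,0),(0,\pm1)\}$ for $1\le m\le n$, and $w_m\notin\{(j,0): j\le 0\}$ for $1\le m\le n$. Let $a_{i,j}(n)$ be the number of walks on the slit plane of length $n$ that end at $(i,j)$ (so $a_{0,0}(0)=1$), and let $S_{i,j}(t)=\sum_{n\ge0}a_{i,j}(n)t^n$. \textbf{Proposition.} For every $\ell\ge 0$ the series $S_{\ell,0}(1/4)$ converges. Let $k\ge1$ be an integer. As $n$ tends to infinity, the proportion of walks on the slit plane of length $n$ that visit $(k,0)$ tends to $$p_k=S_{k,0}(1/4)\,\frac{\sum_{\ell=0}^{k-1}S_{\ell,0}(1/4)}{\sum_{\ell=0}^{k-1}S_{\ell,0}(1/4)^2}<1,$$ while the average number of visits to $(k,0)$, over all walks on the slit plane of length $n$, tends to $$v_k=4(\sqrt2-1)\,S_{k,0}(1/4)\sum_{\ell=0}^{k-1}S_{\ell,0}(1/4).$$ Moreover, for $|x|<1$, $$\sum_{\ell\ge0}S_{\ell,0}(1/4)\,x^\ell=\frac{1}{\sqrt{(1-x)\left(1-x(\sqrt2-1)^2\right)}}.$$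 In particular $$p_1=2-\sqrt2\approx0.586,\qquad p_2=\tfrac{5}{34}(19-11\sqrt2)\approx0.506,\qquad p_2<p_1,$$ $$v_1=4(3\sqrt2-4)\approx0.97,\qquad v_2=10(22\sqrt2-31)\approx1.13,\qquad v_1<v_2,$$ where the decimal values are correct to the number of digits shown. -/

import Mathlib

/-- The unit steps (east, west, north, south) of the square lattice `ℤ × ℤ`. -/
def latticeSteps : Finset (ℤ × ℤ) := {(1, 0), (-1, 0), (0, 1), (0, -1)}

/-- The horizontal half-axis `{(k, 0) : k ≤ 0}`. -/
def halfAxis : Set (ℤ × ℤ) := {p | p.1 ≤ 0 ∧ p.2 = 0}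

/-- `w = (w 0, w 1, …, w n)` is an `n`-step walk on the slit plane: a square lattice walk that
starts from the origin and never returns to the half-axis after its starting point. -/
structure IsSlitWalk {n : ℕ} (w : Fin (n + 1) → ℤ × ℤ) : Prop where
  start : w 0 = (0, 0)
  step : ∀ i : Fin n, w i.succ - w i.castSucc ∈ latticeSteps
  avoid : ∀ i : Fin n, w i.succ ∉ halfAxis

theorem finite_setOf_isSlitWalk (n : ℕ) :
    {w : Fin (n + 1) → ℤ × ℤ | IsSlitWalk w}.Finite := by
  refine Set.Finite.of_finite_image (f := fun w (i : Fin n) => w i.succ - w i.castSucc) ?_ ?_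
  · refine (Set.Finite.pi' (fun _ : Fin n => latticeSteps.finite_toSet)).subset ?_
    rintro _ ⟨w, hw, rfl⟩ i
    exact IsSlitWalk.step hw i
  · intro w hw w' hw' h
    funext i
    induction i using Fin.induction with
    | zero => rw [IsSlitWalk.start hw, IsSlitWalk.start hw']
    | succ i ih =>
      have h1 := congrFun h i
      simp only [ih] at h1
      exact sub_left_injective h1

/-- The finite set of all `n`-step walks on the slit plane. -/
noncomputable def slitWalks (n : ℕ) : Finset (Fin (n + 1) → ℤ × ℤ) :=
  (finite_setOf_isSlitWalk n).toFinset

/-- The number of times the walk `w` visits the point `p`. -/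
def visits {n : ℕ} (p : ℤ × ℤ) (w : Fin (n + 1) → ℤ × ℤ) : ℕ :=
  (Finset.univ.filter fun i => w i = p).card

/-- The number `a_{i,j}(n)` of `n`-step walks on the slit plane that end at `(i, j)`. -/
noncomputable def walkCount (i j : ℤ) (n : ℕ) : ℕ :=
  ((slitWalks n).filter fun w => w (Fin.last n) = (i, j)).card

/-- The value at `t` of the series `S_{i,j}(t) = ∑ₙ a_{i,j}(n) tⁿ`. -/
noncomputable def slitS (i j : ℤ) (t : ℝ) : ℝ := ∑' n : ℕ, (walkCount i j n : ℝ) * t ^ n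

/-- The proportion of `n`-step walks on the slit plane that visit `p`. -/
noncomputable def visitProportion (p : ℤ × ℤ) (n : ℕ) : ℝ :=
  (((slitWalks n).filter fun w => ∃ i, w i = p).card : ℝ) / ((slitWalks n).card : ℝ)

/-- The average number of visits to `p` of `n`-step walks on the slit plane. -/
noncomputable def averageVisits (p : ℤ × ℤ) (n : ℕ) : ℝ :=
  (∑ w ∈ slitWalks n, (visits p w : ℝ)) / ((slitWalks n).card : ℝ)

/-- `p_k = S_{k,0}(1/4) (∑_{ℓ<k} S_{ℓ,0}(1/4)) / (∑_{ℓ<k} S_{ℓ,0}(1/4)²)`. -/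
noncomputable def slitP (k : ℕ) : ℝ :=
  slitS k 0 (1 / 4) * ((∑ l ∈ Finset.range k, slitS l 0 (1 / 4)) /
    ∑ l ∈ Finset.range k, slitS l 0 (1 / 4) ^ 2)

/-- `v_k = 4 (√2 - 1) S_{k,0}(1/4) ∑_{ℓ<k} S_{ℓ,0}(1/4)`. -/
noncomputable def slitV (k : ℕ) : ℝ :=
  4 * (√2 - 1) * slitS k 0 (1 / 4) * ∑ l ∈ Finset.range k, slitS l 0 (1 / 4)

/-! ### Square roots of power series and two binomial series -/

namespace SlitPlane
open PowerSeries

/-! Both statistics are coefficient ratios of generating functions in the length variable t. Write S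
for all slit walks (`totalGF`), S_l for those ending at (l,0) (`slitGF`), and E for loops at the
origin avoiding the strictly negative half-axis (`loopGF`).

Combinatorics. Cutting a walk at its last visit to a point (`avoidGF_insert`), successively at
(1,0), ..., (k,0), together with reversal and translation, shows that the walks starting from (k,0)
and avoiding the half-axis have series S E ∑_{l<k} S_l (`totalGF_from`), and those returning to
(k,0) have series E ∑_{l<k} S_l² (`green_self`). Hence visits to (k,0) are counted by S_k · S · E ∑
S_l, and walks that visit it by S_k · S · ∑ S_l / ∑ S_l².

Explicit series. With C the Catalan series, u = C(t) - 1 and v = 1 - C(-t), the kernel (1 - t(x +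
1/x))² - 4t² factors into parts in x and in 1/x (`exists_kernel_factorization`). This gives ∑ S_l
x^l = ((1 - xu)(1 - xv))^(-1/2) and E = C(t) C(-t) (`slitGF_eq`, `loopGF_eq`). A walk started
farther to the right than its length cannot meet the half-axis, so S · E · ∑ S_l = 1/(1 - 4t),
whence S = (1 - 4t)^(-3/4) (C(t) C(-t))^(-1/2) (`totalGF_eq`).

Asymptotics. The coefficients of (1 - 4t)^(-3/4) are 4^n `quartCoeff n`. Series whose coefficients
are absolutely summable against 4^(-n) / `quartCoeff n` form an algebra on which evaluation at 1/4
is multiplicative; for f in it, dominated convergence shows that the ratio of the n-th coefficients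
of f · S and S tends to f(1/4) (`tendsto_coeff_mul_totalGF`). At t = 1/4 one has u = 1, v = (√2 -
1)² and E = 4(√2 - 1). Finally p_k < 1 because S_l(1/4) strictly decreases in l. -/

theorem eq_of_sq_eq_sq {A : Type*} [CommRing A] [Algebra ℝ A] {f g : A⟦X⟧}
    (hf : constantCoeff f = 1) (hg : constantCoeff g = 1) (h : f ^ 2 = g ^ 2) : f = g := by
  have hu : IsUnit (f + g) := by
    rw [PowerSeries.isUnit_iff_constantCoeff, map_add, hf, hg]
    have h2 : (1 + 1 : A) = algebraMap ℝ A 2 := by rw [map_ofNat]; norm_num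
    rw [h2]
    exact (IsUnit.mk0 (2 : ℝ) two_ne_zero).map _
  have h0 : (f + g) * (f - g) = 0 := by linear_combination h
  exact sub_eq_zero.1 (hu.mul_right_eq_zero.1 h0)

/-- The coefficients `binom(2n, n) / 4 ^ n` of `(1 - x) ^ (-1/2)`. -/
noncomputable def halfCoeff (n : ℕ) : ℝ := ∏ i ∈ Finset.range n, ((2 * i + 1) / (2 * i + 2) : ℝ)

theorem halfCoeff_zero : halfCoeff 0 = 1 := by simp [halfCoeff]

theorem halfCoeff_succ (n : ℕ) :
    halfCoeff (n + 1) = halfCoeff n * ((2 * n + 1) / (2 * n + 2)) := Finset.prod_range_succ _ _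

theorem halfCoeff_pos (n : ℕ) : 0 < halfCoeff n := Finset.prod_pos fun i _ => by positivity

theorem halfCoeff_succ_lt (n : ℕ) : halfCoeff (n + 1) < halfCoeff n := by
  rw [halfCoeff_succ]
  refine mul_lt_of_lt_one_right (halfCoeff_pos n) ?_
  rw [div_lt_one (by positivity)]
  linarith

/-- The power series `(1 - X) ^ (-1/2)`. -/
noncomputable def halfSeries : ℝ⟦X⟧ := PowerSeries.mk halfCoeff

theorem halfSeries_sq : halfSeries ^ 2 * (1 - X) = 1 := by
  -- The ratio of consecutive coefficients is this differential equation; it makes the derivative of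
  -- F² (1 - X) vanish.
  have hode : (derivative ℝ halfSeries) * (2 * (1 - X)) = halfSeries := by
    ext n
    rw [show derivative ℝ halfSeries * (2 * (1 - X)) =
      (2 : ℝ) • (derivative ℝ halfSeries) - (2 : ℝ) • (derivative ℝ halfSeries * X) by
        rw [← smul_sub, two_smul]; ring]
    rcases n with _ | n
    · simp only [map_sub, coeff_smul, coeff_zero_mul_X, coeff_derivative, halfSeries, coeff_mk,
        halfCoeff_succ, halfCoeff_zero]
      norm_num
    · simp only [map_sub, coeff_smul, coeff_derivative, coeff_succ_mul_X, halfSeries, coeff_mk,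
        halfCoeff_succ (n + 1), smul_eq_mul]
      push_cast
      field_simp
      ring
  refine derivative.ext ?_ ?_
  · simp only [Derivation.leibniz, Derivation.leibniz_pow, map_sub, Derivation.map_one_eq_zero,
      derivative_X, smul_eq_mul, nsmul_eq_mul]
    push_cast
    linear_combination halfSeries * hode
  · simp [halfSeries, halfCoeff_zero]

/-- Substitute 1 - f, which has no constant term, into the binomial series (1 - X)^(-1/2). -/
theorem exists_inv_sqrt {A : Type*} [CommRing A] [Algebra ℝ A] {f : A⟦X⟧}
    (hf : constantCoeff f = 1) : ∃ g : A⟦X⟧, constantCoeff g = 1 ∧ g ^ 2 * f = 1 := by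
  have h0 : constantCoeff (1 - f) = 0 := by simp [hf]
  have hs : HasSubst (1 - f) := HasSubst.of_constantCoeff_zero' h0
  have e1 : (1 : ℝ⟦X⟧).subst (1 - f) = 1 := by
    rw [← coe_substAlgHom hs, map_one]
  refine ⟨halfSeries.subst (1 - f), ?_, ?_⟩
  · have h1 : constantCoeff ((halfSeries - 1).subst (1 - f)) = 0 :=
      constantCoeff_subst_eq_zero h0 _ (by simp [halfSeries, halfCoeff_zero])
    rw [subst_sub hs, e1, map_sub] at h1
    simpa [sub_eq_zero] using h1
  · have := congrArg (fun h : ℝ⟦X⟧ => h.subst (1 - f)) halfSeries_sq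
    simp only [subst_mul hs, subst_pow hs, subst_sub hs, subst_X hs, e1] at this
    simpa using this

/-- The coefficients of `(1 - x) ^ (-3/4)`. -/
noncomputable def quartCoeff (n : ℕ) : ℝ := ∏ i ∈ Finset.range n, ((4 * i + 3) / (4 * i + 4) : ℝ)

theorem quartCoeff_zero : quartCoeff 0 = 1 := by simp [quartCoeff]

theorem quartCoeff_succ (n : ℕ) :
    quartCoeff (n + 1) = quartCoeff n * ((4 * n + 3) / (4 * n + 4)) := Finset.prod_range_succ _ _

theorem quartCoeff_pos (n : ℕ) : 0 < quartCoeff n := Finset.prod_pos fun i _ => by positivity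

/-- The factors (4i + 3)/(4i + 4) increase with i. This makes 1 / `quartCoeff` a submultiplicative
weight, which underlies the asymptotic argument. -/
theorem quartCoeff_mul_le (m n : ℕ) : quartCoeff m * quartCoeff n ≤ quartCoeff (m + n) := by
  induction m with
  | zero => simp [quartCoeff_zero]
  | succ m ih =>
    rw [quartCoeff_succ, add_right_comm, quartCoeff_succ, mul_right_comm]
    refine mul_le_mul ih ?_ (by positivity) (quartCoeff_pos _).le
    rw [div_le_div_iff₀ (by positivity) (by positivity)]
    push_cast
    nlinarith [Nat.cast_nonneg (α := ℝ) n]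

/-- The power series `(1 - 4 X) ^ (-3/4)`. -/
noncomputable def quartSeries : ℝ⟦X⟧ := PowerSeries.mk fun n => 4 ^ n * quartCoeff n

theorem quartSeries_pow : quartSeries ^ 4 * (1 - 4 * X) ^ 3 = 1 := by
  have hode : (derivative ℝ quartSeries) * (1 - 4 * X) = 3 * quartSeries := by
    ext n
    rw [show derivative ℝ quartSeries * (1 - 4 * X) =
      (derivative ℝ quartSeries) - (4 : ℝ) • (derivative ℝ quartSeries * X) by
        rw [ofNat_smul_eq_nsmul]; simp; ring,
      show 3 * quartSeries = (3 : ℝ) • quartSeries by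
        rw [ofNat_smul_eq_nsmul]; simp]
    rcases n with _ | n
    · simp only [map_sub, coeff_smul, coeff_zero_mul_X, coeff_derivative, quartSeries, coeff_mk,
        quartCoeff_succ, quartCoeff_zero]
      norm_num
    · simp only [map_sub, coeff_smul, coeff_derivative, coeff_succ_mul_X, quartSeries, coeff_mk,
        quartCoeff_succ (n + 1), smul_eq_mul]
      push_cast
      field_simp
      ring
  have h4 : derivative ℝ (4 : ℝ⟦X⟧) = 0 := by
    rw [← map_ofNat (PowerSeries.C (R := ℝ)) 4, derivative_C]
  refine derivative.ext ?_ ?_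
  · simp only [Derivation.leibniz, Derivation.leibniz_pow, map_sub, Derivation.map_one_eq_zero,
      derivative_X, smul_eq_mul, nsmul_eq_mul, h4]
    push_cast
    linear_combination 4 * quartSeries ^ 3 * (1 - 4 * X) ^ 2 * hode
  · simp [quartSeries, quartCoeff_zero]

end SlitPlane

/-! ### Catalan series and factorization of the kernel -/

namespace SlitPlane
open PowerSeries

/-- The generating function `C` of the Catalan numbers over `ℝ`. -/
noncomputable def cat : ℝ⟦X⟧ := PowerSeries.mk fun n => (catalan n : ℝ)

/-- The series `C(-X)`. -/
noncomputable def catNeg : ℝ⟦X⟧ := PowerSeries.mk fun n => (-1) ^ n * (catalan n : ℝ)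

theorem cat_eq : cat = 1 + X * cat ^ 2 := by
  have h := congrArg (PowerSeries.map (Nat.castRingHom ℝ)) catalanSeries_sq_mul_X_add_one
  have h1 : PowerSeries.map (Nat.castRingHom ℝ) catalanSeries = cat := by
    ext n; simp [cat]
  simp only [map_add, map_mul, map_pow, map_X, map_one, h1] at h
  linear_combination -h

theorem catNeg_eq : catNeg = 1 - X * catNeg ^ 2 := by
  have h1 : rescale (-1 : ℝ) cat = catNeg := by
    ext n; simp [cat, catNeg]
  have h := congrArg (rescale (-1 : ℝ)) cat_eq
  simp only [map_add, map_mul, map_pow, map_one, h1, rescale_neg_one_X] at h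
  linear_combination h

theorem constantCoeff_map' {A B : Type*} [CommRing A] [CommRing B] (φ : A →+* B) (f : A⟦X⟧) :
    constantCoeff (PowerSeries.map φ f) = φ (constantCoeff f) := by
  rw [← coeff_zero_eq_constantCoeff_apply, coeff_map, coeff_zero_eq_constantCoeff_apply]

theorem constantCoeff_cat : constantCoeff cat = 1 := by
  simp [cat]

theorem constantCoeff_catNeg : constantCoeff catNeg = 1 := by
  simp [catNeg]

section
variable {A : Type*} [CommRing A] [Algebra ℝ A]

/-- The factor `(1 - x u) (1 - x v)`, where `u = C - 1` and `v = 1 - C(-X)`. -/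
noncomputable def deltaFactor (x : A) : A⟦X⟧ :=
  (1 - PowerSeries.C x * (PowerSeries.map (algebraMap ℝ A) cat - 1)) *
    (1 - PowerSeries.C x * (1 - PowerSeries.map (algebraMap ℝ A) catNeg))

theorem map_map_algebraMap {A B : Type*} [CommRing A] [Algebra ℝ A] [CommRing B] [Algebra ℝ B]
    (φ : A →ₐ[ℝ] B) (f : ℝ⟦X⟧) :
    PowerSeries.map (φ : A →+* B) (PowerSeries.map (algebraMap ℝ A) f) =
      PowerSeries.map (algebraMap ℝ B) f := by
  ext n
  rw [coeff_map, coeff_map, coeff_map]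
  exact φ.commutes _

theorem map_deltaFactor {B : Type*} [CommRing B] [Algebra ℝ B] (φ : A →ₐ[ℝ] B) (x : A) :
    PowerSeries.map (φ : A →+* B) (deltaFactor x) = deltaFactor (φ x) := by
  simp [deltaFactor, map_map_algebraMap]

theorem constantCoeff_deltaFactor (x : A) : constantCoeff (deltaFactor x) = 1 := by
  simp [deltaFactor, constantCoeff_map', constantCoeff_cat, constantCoeff_catNeg]

end

theorem exists_axisSeries : ∃ g : (Polynomial ℝ)⟦X⟧, constantCoeff g = 1 ∧
    g ^ 2 * deltaFactor Polynomial.X = 1 :=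
  exists_inv_sqrt (constantCoeff_deltaFactor _)

/-- The series `((1 - x u) (1 - x v)) ^ (-1/2)`, with polynomial coefficients in `x`. -/
noncomputable def axisSeries : (Polynomial ℝ)⟦X⟧ := exists_axisSeries.choose

theorem constantCoeff_axisSeries : constantCoeff axisSeries = 1 := exists_axisSeries.choose_spec.1

theorem axisSeries_sq : axisSeries ^ 2 * deltaFactor Polynomial.X = 1 :=
  exists_axisSeries.choose_spec.2

theorem axisSeries_eval_zero :
    PowerSeries.map ((Polynomial.aeval (0 : ℝ) : Polynomial ℝ →ₐ[ℝ] ℝ) :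
      Polynomial ℝ →+* ℝ) axisSeries = 1 := by
  have h := congrArg (PowerSeries.map ((Polynomial.aeval (0 : ℝ) : Polynomial ℝ →ₐ[ℝ] ℝ) :
    Polynomial ℝ →+* ℝ)) axisSeries_sq
  rw [map_mul, map_pow, map_deltaFactor] at h
  refine eq_of_sq_eq_sq ?_ (by simp) ?_
  · simp [constantCoeff_map', constantCoeff_axisSeries]
  · simpa [deltaFactor] using h

/-- `axisSeries` with coefficients viewed as Laurent polynomials. -/
noncomputable def axisLaurent : (LaurentPolynomial ℝ)⟦X⟧ :=
  PowerSeries.map (Polynomial.toLaurent : Polynomial ℝ →+* LaurentPolynomial ℝ) axisSeries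

theorem coeff_map_toLaurent (g : (Polynomial ℝ)⟦X⟧) (n : ℕ) (i : ℤ) :
    (coeff n (PowerSeries.map (Polynomial.toLaurent : Polynomial ℝ →+* LaurentPolynomial ℝ)
      g)).coeff i = if 0 ≤ i then (coeff n g).coeff i.toNat else 0 := by
  have : ∀ p : Polynomial ℝ, (Polynomial.toLaurent p).coeff i =
      if 0 ≤ i then p.coeff i.toNat else 0 := by
    intro p
    rw [LaurentPolynomial.coeff_toLaurent]
    split_ifs with h
    · lift i to ℕ using h
      exact Finsupp.mapDomain_apply Nat.castEmbedding.injective p.toFinsupp.coeff i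
    · refine Finsupp.mapDomain_of_notMem_range _ _ ?_
      rintro ⟨j, rfl⟩
      simp at h
  simpa using this _

/-- `x + x⁻¹`. -/
noncomputable def zLaurent : (LaurentPolynomial ℝ)⟦X⟧ :=
  PowerSeries.C (LaurentPolynomial.T 1) + PowerSeries.C (LaurentPolynomial.T (-1))

theorem exists_inv_cat_mul_catNeg : ∃ q : ℝ⟦X⟧, q * (cat * catNeg) = 1 := by
  have : IsUnit (cat * catNeg) := by
    rw [PowerSeries.isUnit_iff_constantCoeff]
    simp [constantCoeff_cat, constantCoeff_catNeg]
  exact this.exists_left_inv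

/-- Let D₁ = (1 - xu)(1 - xv), and let D₂ be D₁ with 1/x for x. Then D₁ D₂ q² is the kernel (1 -
tz)² - 4t², where z = x + 1/x. Take T = D₁^(-1/2), N = q D₂^(1/2) and Q = q (D₁ D₂)^(1/2), so that
TQ = N and Q² is the kernel; l = (1 - tz - Q)/(2t) solves the stated quadratic equation. The point
is that T has only nonnegative powers of x and N only nonpositive ones. -/
theorem exists_kernel_factorization (q : ℝ⟦X⟧) (hq : q * (cat * catNeg) = 1) :
    ∃ l N : (LaurentPolynomial ℝ)⟦X⟧, constantCoeff l = 0 ∧ l = X * (zLaurent * l + 1 + l ^ 2) ∧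
      axisLaurent = X * (zLaurent * axisLaurent + 2 * (axisLaurent * l)) + N ∧
      (∀ n i, 0 < i → (coeff n N).coeff i = 0) ∧ ∀ n, (coeff n N).coeff 0 = coeff n q := by
  set ν : (Polynomial ℝ)⟦X⟧ := PowerSeries.map (algebraMap ℝ _) q *
    (deltaFactor Polynomial.X * axisSeries) with hν
  set inv : LaurentPolynomial ℝ →ₐ[ℝ] LaurentPolynomial ℝ :=
    (LaurentPolynomial.invert (R := ℝ)).toAlgHom with hinv
  set φ₁ : Polynomial ℝ →ₐ[ℝ] LaurentPolynomial ℝ := Polynomial.toLaurentAlg with hφ₁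
  set φ₂ : Polynomial ℝ →ₐ[ℝ] LaurentPolynomial ℝ := inv.comp φ₁ with hφ₂
  set N : (LaurentPolynomial ℝ)⟦X⟧ := PowerSeries.map (φ₂ : Polynomial ℝ →+* LaurentPolynomial ℝ) ν with hN
  have hNc (n i) : (coeff n N).coeff i = if 0 ≤ -i then (coeff n ν).coeff (-i).toNat else 0 := by
    rw [← coeff_map_toLaurent]
    simp [hN, hφ₂, hφ₁, hinv]
  have a1 := congrArg (PowerSeries.map (φ₁ : Polynomial ℝ →+* LaurentPolynomial ℝ)) axisSeries_sq
  have a2 := congrArg (PowerSeries.map (φ₂ : Polynomial ℝ →+* LaurentPolynomial ℝ)) axisSeries_sq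
  have x1 : φ₁ Polynomial.X = LaurentPolynomial.T 1 := by simp [hφ₁]
  have x2 : φ₂ Polynomial.X = LaurentPolynomial.T (-1) := by simp [hφ₂, hφ₁, hinv]
  rw [map_mul, map_pow, map_deltaFactor, map_one, x1] at a1
  rw [map_mul, map_pow, map_deltaFactor, map_one, x2] at a2
  have hN' : N = PowerSeries.map (algebraMap ℝ _) q * (deltaFactor (LaurentPolynomial.T (-1)) *
      PowerSeries.map (φ₂ : Polynomial ℝ →+* LaurentPolynomial ℝ) axisSeries) := by
    rw [hN, hν, map_mul, map_mul, map_map_algebraMap, map_deltaFactor, x2]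
  have hT : axisLaurent = PowerSeries.map (φ₁ : Polynomial ℝ →+* LaurentPolynomial ℝ) axisSeries := rfl
  rw [← hT] at a1
  set D₁ := deltaFactor (LaurentPolynomial.T 1 : LaurentPolynomial ℝ) with hD₁
  set D₂ := deltaFactor (LaurentPolynomial.T (-1) : LaurentPolynomial ℝ) with hD₂
  set Q := N * (D₁ * axisLaurent) with hQ
  have hxx : (PowerSeries.C (LaurentPolynomial.T 1) : (LaurentPolynomial ℝ)⟦X⟧) *
      PowerSeries.C (LaurentPolynomial.T (-1)) = 1 := by
    rw [← map_mul, ← LaurentPolynomial.T_add]; simp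
  have hc := congrArg (PowerSeries.map (algebraMap ℝ (LaurentPolynomial ℝ))) cat_eq
  have hm := congrArg (PowerSeries.map (algebraMap ℝ (LaurentPolynomial ℝ))) catNeg_eq
  have hq' := congrArg (PowerSeries.map (algebraMap ℝ (LaurentPolynomial ℝ))) hq
  simp only [map_mul, map_pow, map_X, map_one, map_add, map_sub] at hc hm hq'
  have hDD : D₁ * D₂ = (PowerSeries.map (algebraMap ℝ (LaurentPolynomial ℝ)) cat) ^ 2 *
      (PowerSeries.map (algebraMap ℝ (LaurentPolynomial ℝ)) catNeg) ^ 2 *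
      ((1 - X * zLaurent) ^ 2 - 4 * X ^ 2) := by
    rw [hD₁, hD₂, deltaFactor, deltaFactor, zLaurent]
    generalize (PowerSeries.C (LaurentPolynomial.T 1) : (LaurentPolynomial ℝ)⟦X⟧) = x at *
    generalize (PowerSeries.C (LaurentPolynomial.T (-1)) : (LaurentPolynomial ℝ)⟦X⟧) = y at *
    generalize (PowerSeries.map (algebraMap ℝ (LaurentPolynomial ℝ)) cat) = c at *
    generalize (PowerSeries.map (algebraMap ℝ (LaurentPolynomial ℝ)) catNeg) = d at *
    -- Uses xy = 1 and u = tC², which gives 1 + u² = C² - 2u = C²(1 - 2t).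
    have e1 : (1 - x * (c - 1)) * (1 - y * (c - 1)) = c ^ 2 * (1 - 2 * X - X * (x + y)) := by
      linear_combination (c - 1) ^ 2 * hxx + (-(x + y) - 2) * hc
    have e2 : (1 - x * (1 - d)) * (1 - y * (1 - d)) = d ^ 2 * (1 + 2 * X - X * (x + y)) := by
      linear_combination (1 - d) ^ 2 * hxx + (x + y - 2) * hm
    calc _ = ((1 - x * (c - 1)) * (1 - y * (c - 1))) * ((1 - x * (1 - d)) * (1 - y * (1 - d))) := by
          ring
      _ = _ := by rw [e1, e2]; ring
  have hQ2 : Q ^ 2 = (1 - X * zLaurent) ^ 2 - 4 * X ^ 2 := by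
    generalize hc' : (PowerSeries.map (algebraMap ℝ (LaurentPolynomial ℝ)) cat) = c at *
    generalize hd' : (PowerSeries.map (algebraMap ℝ (LaurentPolynomial ℝ)) catNeg) = d at *
    generalize hqq : (PowerSeries.map (algebraMap ℝ (LaurentPolynomial ℝ)) q) = r at *
    generalize hss : (PowerSeries.map (φ₂ : Polynomial ℝ →+* LaurentPolynomial ℝ) axisSeries) = s at *
    calc Q ^ 2 = r ^ 2 * (D₁ * D₂) * (s ^ 2 * D₂) * (axisLaurent ^ 2 * D₁) := by
          rw [hQ, hN']; ring
      _ = (r * (c * d)) ^ 2 * ((1 - X * zLaurent) ^ 2 - 4 * X ^ 2) := by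
          rw [a1, a2, hDD]; ring
      _ = _ := by rw [hq']; ring
  have hTQ : axisLaurent * Q = N := by
    linear_combination N * a1
  have hQ0 : constantCoeff Q = 1 := by
    have q0 : constantCoeff q = 1 := by
      have := congrArg constantCoeff hq
      simpa [constantCoeff_cat, constantCoeff_catNeg] using this
    simp [hQ, hN', hT, constantCoeff_map', hD₁, hD₂, constantCoeff_deltaFactor, constantCoeff_axisSeries, q0]
  clear_value ν Q N D₁ D₂
  -- Extracting X twice gives Q = 1 - Xz + X² Q₂, so the division by 2t is legitimate and l = -X Q₂
  -- / 2.
  obtain ⟨Q₁, hQ₁⟩ : X ∣ Q - 1 := by rw [X_dvd_iff]; simp [hQ0]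
  have e1 : 2 * Q₁ + X * Q₁ ^ 2 = -2 * zLaurent + X * (zLaurent ^ 2 - 4) := by
    apply X_mul_cancel
    linear_combination hQ2 - (Q + 1 + X * Q₁) * hQ₁
  obtain ⟨Q₂, hQ₂⟩ : X ∣ Q₁ + zLaurent := by
    rw [X_dvd_iff]
    have := congrArg constantCoeff e1
    simp only [map_add, map_mul, constantCoeff_X, map_neg, zero_mul, add_zero, map_ofNat] at this ⊢
    have h2 : (2 : LaurentPolynomial ℝ) * (constantCoeff Q₁ + constantCoeff zLaurent) = 0 := by
      linear_combination this
    have half : (2 : LaurentPolynomial ℝ) * algebraMap ℝ _ (1 / 2) = 1 := by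
      rw [← map_ofNat (algebraMap ℝ (LaurentPolynomial ℝ)), ← map_mul]
      norm_num
    linear_combination algebraMap ℝ (LaurentPolynomial ℝ) (1 / 2) * h2 -
      (constantCoeff Q₁ + constantCoeff zLaurent) * half
  have e2 : 2 * Q₂ + Q₁ ^ 2 = zLaurent ^ 2 - 4 := by
    apply X_mul_cancel
    linear_combination e1 - 2 * hQ₂
  have half : (2 : (LaurentPolynomial ℝ)⟦X⟧) * PowerSeries.C (algebraMap ℝ _ (1 / 2)) = 1 := by
    rw [← map_ofNat PowerSeries.C, ← map_mul, ← map_ofNat (algebraMap ℝ (LaurentPolynomial ℝ)),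
      ← map_mul]
    norm_num
  generalize (PowerSeries.C (algebraMap ℝ _ (1 / 2)) : (LaurentPolynomial ℝ)⟦X⟧) = h at half
  have e3 : Q₁ = X * Q₂ - zLaurent := by linear_combination hQ₂
  have e4 : Q = 1 - X * zLaurent + X ^ 2 * Q₂ := by linear_combination hQ₁ + X * hQ₂
  refine ⟨X * (-h * Q₂), N, by simp, ?_, ?_, ?_, ?_⟩
  · rw [e3] at e2
    have e5 : -h * Q₂ = zLaurent * (X * (-h * Q₂)) + 1 + (X * (-h * Q₂)) ^ 2 := by
      linear_combination (-h ^ 2) * e2 + (h * Q₂ + h * X * Q₂ * (-zLaurent) + 2 * h + 1) * half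
    exact congrArg (X * ·) e5
  · rw [e4] at hTQ
    linear_combination hTQ + X ^ 2 * axisLaurent * Q₂ * half
  · intro n i hi
    rw [hNc, if_neg (by omega)]
  · intro n
    rw [hNc, if_pos (by simp)]
    -- At x = 0 both `deltaFactor` and `axisSeries` equal 1, so only q survives.
    have h0 := axisSeries_eval_zero
    have h1 := congrArg (PowerSeries.map ((Polynomial.aeval (0 : ℝ) :
      Polynomial ℝ →ₐ[ℝ] ℝ) : Polynomial ℝ →+* ℝ)) hν
    rw [map_mul, map_mul, map_deltaFactor, h0, map_map_algebraMap] at h1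
    have h2 := congrArg (coeff n) h1
    simpa [deltaFactor, Polynomial.coeff_zero_eq_aeval_zero] using h2

end SlitPlane

/-! ### Generating functions of walks avoiding a set, and their decompositions -/

namespace SlitPlane
open PowerSeries

/-- The number of `n`-step lattice walks from `p` that avoid `K` after their start, each weighted by
the value of `f` at its end. -/
noncomputable def avoidCount (K : Set (ℤ × ℤ)) (f : ℤ × ℤ → ℝ) : ℕ → ℤ × ℤ → ℝ
  | 0, p => f p
  | n + 1, p => ∑ s ∈ latticeSteps, Kᶜ.indicator (avoidCount K f n) (p + s)

/-- The generating function of `avoidCount`. -/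
noncomputable def avoidGF (K : Set (ℤ × ℤ)) (f : ℤ × ℤ → ℝ) (p : ℤ × ℤ) : ℝ⟦X⟧ :=
  PowerSeries.mk fun n => avoidCount K f n p

/-- The generating function of the walks from `p` to `q` that avoid `K` after their start. -/
noncomputable def green (K : Set (ℤ × ℤ)) (p q : ℤ × ℤ) : ℝ⟦X⟧ := avoidGF K (Pi.single q 1) p

variable {K : Set (ℤ × ℤ)} {f : ℤ × ℤ → ℝ}

theorem coeff_indicator (S : Set (ℤ × ℤ)) (Y : ℤ × ℤ → ℝ⟦X⟧) (n : ℕ) (p : ℤ × ℤ) :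
    coeff n (S.indicator Y p) = S.indicator (fun r => coeff n (Y r)) p := by
  by_cases h : p ∈ S <;> simp [h]

theorem coeff_avoidGF (n : ℕ) (p : ℤ × ℤ) : coeff n (avoidGF K f p) = avoidCount K f n p := by
  simp [avoidGF]

theorem avoidGF_eq (p : ℤ × ℤ) : avoidGF K f p = PowerSeries.C (f p) +
    X * ∑ s ∈ latticeSteps, Kᶜ.indicator (avoidGF K f) (p + s) := by
  ext n
  rcases n with _ | n
  · simp [avoidGF, avoidCount]
  · simp only [coeff_avoidGF, avoidCount, map_add, coeff_succ_X_mul, map_sum, coeff_indicator,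
      coeff_C, Nat.add_eq_zero_iff, one_ne_zero, and_false, if_false, zero_add]

/-- The factor X makes each coefficient depend only on earlier ones, so the first-step system has
one solution. Identities between walk series are then proved by checking this system. -/
theorem eq_avoidGF {Y : ℤ × ℤ → ℝ⟦X⟧} (h : ∀ p, Y p = PowerSeries.C (f p) +
    X * ∑ s ∈ latticeSteps, Kᶜ.indicator Y (p + s)) (p : ℤ × ℤ) : Y p = avoidGF K f p := by
  ext n
  induction n generalizing p with
  | zero => rw [h, avoidGF_eq]; simp
  | succ n ih =>
    rw [h, avoidGF_eq]
    simp only [map_add, coeff_succ_X_mul, map_sum, coeff_indicator, ih]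

/-- Cut at the last visit to z: before it, a walk from p to z avoiding K; after it, one that also
avoids z. The other term counts walks that never visit z, and there are none when p = z. -/
theorem avoidGF_insert {z : ℤ × ℤ} (hz : z ∉ K) (p : ℤ × ℤ) :
    avoidGF K f p = (if p = z then 0 else avoidGF (insert z K) f p) +
      green K p z * avoidGF (insert z K) f z := by
  symm
  refine eq_avoidGF (Y := fun p => (if p = z then 0 else avoidGF (insert z K) f p) +
    green K p z * avoidGF (insert z K) f z) (fun p => ?_) p
  have key : ∀ r, Kᶜ.indicator (fun p => (if p = z then 0 else avoidGF (insert z K) f p) +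
      green K p z * avoidGF (insert z K) f z) r =
      (insert z K)ᶜ.indicator (avoidGF (insert z K) f) r +
      Kᶜ.indicator (fun p => green K p z) r * avoidGF (insert z K) f z := by
    intro r
    by_cases hr : r ∈ K
    · simp [hr]
    · by_cases hrz : r = z
      · subst hrz; simp [hr]
      · simp [hr, hrz]
  have e1 := avoidGF_eq (K := insert z K) (f := f) p
  have e2 : green K p z = PowerSeries.C ((Pi.single z 1 : ℤ × ℤ → ℝ) p) +
    X * ∑ s ∈ latticeSteps, Kᶜ.indicator (fun p => green K p z) (p + s) := avoidGF_eq p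
  simp only [key, Finset.sum_add_distrib, ← Finset.sum_mul]
  by_cases hp : p = z
  · subst hp
    simp only [if_true, Pi.single_eq_same, map_one] at e2 ⊢
    linear_combination e1 + avoidGF (insert p K) f p * e2
  · simp only [hp, if_false, ne_eq, not_false_eq_true, Pi.single_eq_of_ne, map_zero] at e2 ⊢
    linear_combination e1 + avoidGF (insert z K) f z * e2

theorem avoidGF_insert_self {z : ℤ × ℤ} (hz : z ∉ K) :
    avoidGF K f z = green K z z * avoidGF (insert z K) f z := by
  simpa using avoidGF_insert (f := f) hz z

theorem avoidCount_nonneg (hf : 0 ≤ f) (n : ℕ) (p : ℤ × ℤ) : 0 ≤ avoidCount K f n p := by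
  induction n generalizing p with
  | zero => exact hf p
  | succ n ih => exact Finset.sum_nonneg fun s _ => Set.indicator_nonneg (fun r _ => ih r) _

theorem green_coeff_nonneg (n : ℕ) (p q : ℤ × ℤ) : 0 ≤ coeff n (green K p q) := by
  rw [green, coeff_avoidGF]
  exact avoidCount_nonneg (Pi.single_nonneg.2 zero_le_one) n p

/-- The definition peels off the first step; here the last one is peeled off, by exchanging the two
sums in the induction. -/
theorem avoidCount_succ_single (n : ℕ) (p q : ℤ × ℤ) :
    avoidCount K (Pi.single q 1) (n + 1) p =
      ∑ s ∈ latticeSteps, Kᶜ.indicator (fun _ => avoidCount K (Pi.single (q - s) 1) n p) q := by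
  induction n generalizing p with
  | zero =>
    refine Finset.sum_congr rfl fun s _ => ?_
    by_cases h : p + s = q
    · subst h
      by_cases hq : p + s ∈ K <;> simp [avoidCount, hq]
    · have h' : p ≠ q - s := fun h' => h (by rw [h']; simp)
      by_cases hq : q ∈ K <;> by_cases hp : p + s ∈ K <;> simp [avoidCount, hq, h, h', hp]
  | succ n ih =>
    rw [avoidCount]
    by_cases hq : q ∈ K
    · simp only [hq, Set.mem_compl_iff, not_true, not_false_eq_true, Set.indicator_of_notMem,
        Finset.sum_const_zero] at ih ⊢
      refine Finset.sum_eq_zero fun s _ => ?_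
      by_cases h : p + s ∈ K <;> simp [h, ih]
    · simp only [hq, Set.mem_compl_iff, not_false_eq_true, Set.indicator_of_mem] at ih ⊢
      simp only [avoidCount]
      rw [Finset.sum_comm]
      refine Finset.sum_congr rfl fun s _ => ?_
      by_cases h : p + s ∈ K
      · simp [h]
      · simp only [Set.mem_compl_iff, h, not_false_eq_true, Set.indicator_of_mem]
        exact ih _

theorem green_eq_last_step {p q : ℤ × ℤ} (hq : q ∉ K) : green K p q =
    PowerSeries.C ((Pi.single q 1 : ℤ × ℤ → ℝ) p) + X * ∑ s ∈ latticeSteps, green K p (q - s) := by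
  ext n
  rcases n with _ | n
  · simp [green, avoidGF, avoidCount]
  · have := avoidCount_succ_single (K := K) n p q
    simp only [green, coeff_avoidGF, this, map_add, coeff_succ_X_mul, map_sum, coeff_C,
      Nat.add_eq_zero_iff, one_ne_zero, and_false, if_false, zero_add]
    simp [hq]

theorem green_eq_zero {p q : ℤ × ℤ} (hq : q ∈ K) (hpq : p ≠ q) : green K p q = 0 := by
  ext n
  rcases n with _ | n
  · simp [green, avoidGF, avoidCount, hpq]
  · rw [green, coeff_avoidGF, avoidCount_succ_single]
    simp [hq]

theorem neg_mem_latticeSteps {s : ℤ × ℤ} (h : s ∈ latticeSteps) : -s ∈ latticeSteps := by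
  simp only [latticeSteps, Finset.mem_insert, Finset.mem_singleton] at h ⊢
  rcases h with rfl | rfl | rfl | rfl <;> simp

theorem sum_latticeSteps_neg {M : Type*} [AddCommMonoid M] (φ : ℤ × ℤ → M) :
    ∑ s ∈ latticeSteps, φ (-s) = ∑ s ∈ latticeSteps, φ s :=
  Finset.sum_nbij' (fun s => -s) (fun s => -s) (fun _ h => neg_mem_latticeSteps h)
    (fun _ h => neg_mem_latticeSteps h) (by simp) (by simp) (by simp)

/-- Reversal of walks. Since only the starting point is exempt from avoiding K, both ends must lie
outside K. -/
theorem avoidCount_comm (n : ℕ) {p q : ℤ × ℤ} (hp : p ∉ K) (hq : q ∉ K) :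
    avoidCount K (Pi.single q 1) n p = avoidCount K (Pi.single p 1) n q := by
  induction n generalizing p with
  | zero =>
    simp only [avoidCount, Pi.single_apply, eq_comm]
  | succ n ih =>
    rw [avoidCount_succ_single n q p, avoidCount,
      ← sum_latticeSteps_neg]
    refine Finset.sum_congr rfl fun s _ => ?_
    rw [← sub_eq_add_neg]
    by_cases h : p - s ∈ K
    · have := green_eq_zero (p := q) h (fun e => hq (e ▸ h))
      have := congrArg (coeff n) this
      rw [green, coeff_avoidGF] at this
      simp [h, this]
    · simp [h, hp, ih h]

theorem green_comm {p q : ℤ × ℤ} (hp : p ∉ K) (hq : q ∉ K) : green K p q = green K q p := by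
  ext n
  simp only [green, coeff_avoidGF]
  exact avoidCount_comm n hp hq

/-- The generating function of the walks from `z` that avoid `K ∪ {z}` until they return to `z`. -/
noncomputable def returnGF (K : Set (ℤ × ℤ)) (z : ℤ × ℤ) : ℝ⟦X⟧ :=
  X * ∑ s ∈ latticeSteps, green (insert z K) z (z - s)

/-- A loop at z is a sequence of first-return excursions. This supplies an inverse of the loop
series without dividing. -/
theorem green_mul_one_sub_returnGF {z : ℤ × ℤ} (hz : z ∉ K) :
    green K z z * (1 - returnGF K z) = 1 := by
  have h := green_eq_last_step (p := z) hz
  have h2 : ∀ q, green K z q = green K z z * green (insert z K) z q := fun q =>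
    avoidGF_insert_self hz
  have h3 : ∑ s ∈ latticeSteps, green K z (z - s) = green K z z *
      ∑ s ∈ latticeSteps, green (insert z K) z (z - s) := by
    rw [Finset.mul_sum]
    exact Finset.sum_congr rfl fun s _ => h2 _
  rw [h3] at h
  simp only [Pi.single_eq_same, map_one] at h
  rw [returnGF]
  linear_combination h

theorem returnGF_coeff_nonneg (n : ℕ) (z : ℤ × ℤ) : 0 ≤ coeff n (returnGF K z) := by
  rcases n with _ | n
  · simp [returnGF]
  · rw [returnGF, coeff_succ_X_mul, map_sum]
    exact Finset.sum_nonneg fun s _ => green_coeff_nonneg _ _ _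

theorem returnGF_coeff_le {z : ℤ × ℤ} (hz : z ∉ K) (n : ℕ) :
    coeff n (returnGF K z) ≤ coeff n (green K z z) := by
  have h : green K z z = 1 + green K z z * returnGF K z := by
    linear_combination green_mul_one_sub_returnGF hz
  rw [h, map_add, coeff_mul]
  have h0 : coeff 0 (green K z z) = 1 := by simp [green, avoidGF, avoidCount]
  have h1 : coeff n (returnGF K z) ≤ ∑ x ∈ Finset.HasAntidiagonal.antidiagonal n,
      coeff x.1 (green K z z) * coeff x.2 (returnGF K z) := by
    have := Finset.single_le_sum (f := fun x : ℕ × ℕ =>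
      coeff x.1 (green K z z) * coeff x.2 (returnGF K z)) (s := Finset.HasAntidiagonal.antidiagonal n)
      (fun x _ => mul_nonneg (green_coeff_nonneg _ _ _) (returnGF_coeff_nonneg _ _))
      (show (0, n) ∈ Finset.HasAntidiagonal.antidiagonal n by simp)
    simpa only [h0, one_mul] using this
  have h2 : (0 : ℝ) ≤ coeff n (1 : ℝ⟦X⟧) := by
    rw [coeff_one]; positivity
  linarith

/-- The half-line `{(i, 0) : i ≤ j}`. -/
def halfLine (j : ℤ) : Set (ℤ × ℤ) := {p | p.1 ≤ j ∧ p.2 = 0}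

theorem halfLine_zero : halfLine 0 = halfAxis := rfl

theorem insert_halfLine (j : ℤ) : insert (j, 0) (halfLine (j - 1)) = halfLine j := by
  ext ⟨a, b⟩
  simp only [halfLine, Set.mem_insert_iff, Prod.mk.injEq, Set.mem_ofPred_eq]
  omega

theorem avoidGF_translate (f : ℤ × ℤ → ℝ) (a j : ℤ) (p : ℤ × ℤ) :
    avoidGF (halfLine (j + a)) f (p + (a, 0)) =
      avoidGF (halfLine j) (fun r => f (r + (a, 0))) p := by
  refine eq_avoidGF (Y := fun p => avoidGF (halfLine (j + a)) f (p + (a, 0))) (fun p => ?_) p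
  rw [avoidGF_eq]
  congr 2
  refine Finset.sum_congr rfl fun s _ => ?_
  have h : p + (a, 0) + s ∈ halfLine (j + a) ↔ p + s ∈ halfLine j := by
    simp [halfLine]
    omega
  by_cases h' : p + s ∈ halfLine j
  · simp [h.2 h', h']
  · simp [mt h.1 h', h', add_right_comm p s]

theorem green_translate (a j i i' : ℤ) :
    green (halfLine (j + a)) (i + a, 0) (i' + a, 0) = green (halfLine j) (i, 0) (i', 0) := by
  have := avoidGF_translate (Pi.single (i' + a, 0) 1) a j (i, 0)
  rw [green, green]
  convert this using 2
  · simp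
  · ext r
    obtain ⟨r, r'⟩ := r
    simp [Pi.single_apply]

/-- The generating function `S_{l,0}` of the walks on the slit plane that end at `(l, 0)`. -/
noncomputable def slitGF (l : ℕ) : ℝ⟦X⟧ := green halfAxis (0, 0) ((l : ℤ), 0)

/-- The generating function of all walks on the slit plane. -/
noncomputable def totalGF : ℝ⟦X⟧ := avoidGF halfAxis 1 (0, 0)

/-- The generating function of the loops at the origin that avoid `{(i, 0) : i < 0}`. -/
noncomputable def loopGF : ℝ⟦X⟧ := green (halfLine (-1)) (0, 0) (0, 0)

/-- Classify walks from (k,0) by the leftmost axis point (j+1,0) they visit, and cut at the last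
visit there. Reversed, the first part goes from (j+1,0) to (k,0): a loop, then a translated slit
walk ending at distance k - (j+1). -/
theorem avoidGF_halfLine (f : ℤ × ℤ → ℝ) (m : ℕ) (k : ℕ) (hm : m ≤ k) :
    (if m = k then 0 else avoidGF (halfLine m) f (k, 0)) +
      ∑ j ∈ Finset.range m, loopGF * slitGF (k - (j + 1)) *
        avoidGF (halfLine ((j : ℤ) + 1)) f ((j : ℤ) + 1, 0) =
    if k = 0 then 0 else avoidGF halfAxis f (k, 0) := by
  induction m with
  | zero => simp [halfLine_zero, eq_comm]
  | succ m ih =>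
    rw [← ih (by omega), Finset.sum_range_succ, if_neg (by omega : m ≠ k)]
    have h1 : (((m : ℤ) + 1, (0 : ℤ)) : ℤ × ℤ) ∉ halfLine m := by simp [halfLine]
    have h2 : (((k : ℤ), (0 : ℤ)) : ℤ × ℤ) ∉ halfLine m := by simp [halfLine]; omega
    have h3 := insert_halfLine (m + 1)
    rw [add_sub_cancel_right] at h3
    have h4 := avoidGF_insert (f := f) h1 (k, 0)
    rw [green_comm h2 h1, h3] at h4
    have h5 : green (halfLine m) ((m : ℤ) + 1, 0) (k, 0) = loopGF * slitGF (k - (m + 1)) := by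
      rw [green, avoidGF_insert_self h1, h3]
      congr 1
      · have := green_translate (m + 1) (-1) 0 0
        rw [← loopGF] at this
        rw [← this]
        simp
      · have := green_translate (m + 1) 0 0 ((k - (m + 1) : ℕ) : ℤ)
        rw [halfLine_zero, ← slitGF] at this
        rw [← this, green]
        push_cast [hm]
        simp
    rw [h5] at h4
    rw [h4]
    have h6 : (((k : ℤ), (0 : ℤ)) = ((m : ℤ) + 1, (0 : ℤ))) ↔ m + 1 = k := by
      simp; omega
    simp only [h6]
    push_cast
    ring

theorem avoidGF_halfAxis {k : ℕ} (hk : 0 < k) (f : ℤ × ℤ → ℝ) : avoidGF halfAxis f (k, 0) =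
    loopGF * ∑ j ∈ Finset.range k, slitGF (k - (j + 1)) *
      avoidGF (halfLine ((j : ℤ) + 1)) f ((j : ℤ) + 1, 0) := by
  have := avoidGF_halfLine f k k le_rfl
  rw [if_pos rfl, if_neg hk.ne', zero_add] at this
  rw [← this, Finset.mul_sum]
  exact Finset.sum_congr rfl fun j _ => by ring

theorem totalGF_from {k : ℕ} (hk : 0 < k) : avoidGF halfAxis 1 (k, 0) =
    totalGF * loopGF * ∑ l ∈ Finset.range k, slitGF l := by
  rw [avoidGF_halfAxis hk, ← Finset.sum_range_reflect (fun l => slitGF l), mul_comm totalGF,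
    mul_assoc]
  congr 1
  rw [Finset.mul_sum]
  refine Finset.sum_congr rfl fun j _ => ?_
  have := avoidGF_translate 1 ((j : ℤ) + 1) 0 (0, 0)
  rw [mul_comm, Nat.sub_sub, add_comm 1 j]
  congr 1
  simp only [zero_add, Prod.mk_add_mk] at this
  rw [this, halfLine_zero]
  rfl

theorem green_self {k : ℕ} (hk : 0 < k) : green halfAxis (k, 0) (k, 0) =
    loopGF * ∑ l ∈ Finset.range k, slitGF l ^ 2 := by
  rw [green, avoidGF_halfAxis hk, ← Finset.sum_range_reflect (fun l => slitGF l ^ 2)]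
  congr 1
  refine Finset.sum_congr rfl fun j hj => ?_
  have hj' := Finset.mem_range.1 hj
  have := green_translate ((j : ℤ) + 1) 0 0 ((k - (j + 1) : ℕ) : ℤ)
  rw [halfLine_zero, ← slitGF, green] at this
  rw [sq, Nat.sub_sub, add_comm 1 j]
  congr 1
  rw [← this]
  push_cast [show j + 1 ≤ k from hj']
  simp

theorem loopGF_mul : loopGF * (1 - X * (green halfAxis (0, 0) (1, 0) +
    green halfAxis (0, 0) (0, 1) + green halfAxis (0, 0) (0, -1))) = 1 := by
  have h := green_mul_one_sub_returnGF (K := halfLine (-1)) (z := (0, 0)) (by simp [halfLine])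
  have h3 := insert_halfLine 0
  rw [zero_sub] at h3
  rw [← loopGF, returnGF, h3, halfLine_zero] at h
  have h4 : green halfAxis (0, 0) (-1, 0) = 0 := green_eq_zero (by simp [halfAxis]) (by simp)
  have h5 : ∑ s ∈ latticeSteps, green halfAxis (0, 0) ((0, 0) - s) = green halfAxis (0, 0) (1, 0) +
      green halfAxis (0, 0) (0, 1) + green halfAxis (0, 0) (0, -1) := by
    simp [latticeSteps, h4]
    ring
  rw [← h5, h]

end SlitPlane

/-! ### From finite sets of walks to coefficients -/

namespace SlitPlane
open PowerSeries

open Classical in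
/-- The finite set of `n`-step lattice walks from `p` that avoid `K` after their start. -/
noncomputable def walkSet (K : Set (ℤ × ℤ)) : (n : ℕ) → ℤ × ℤ → Finset (Fin (n + 1) → ℤ × ℤ)
  | 0, p => {fun _ => p}
  | n + 1, p => (latticeSteps.filter fun s => p + s ∉ K).biUnion fun s =>
      (walkSet K n (p + s)).image (Fin.cons p)

variable {K : Set (ℤ × ℤ)}

theorem mem_walkSet {n : ℕ} {p : ℤ × ℤ} {w : Fin (n + 1) → ℤ × ℤ} : w ∈ walkSet K n p ↔
    w 0 = p ∧ (∀ i : Fin n, w i.succ - w i.castSucc ∈ latticeSteps) ∧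
      ∀ i : Fin n, w i.succ ∉ K := by
  induction n generalizing p with
  | zero =>
    simp only [walkSet, Finset.mem_singleton, IsEmpty.forall_iff, and_true]
    refine ⟨fun h => by rw [h], fun h => funext fun i => ?_⟩
    rw [Fin.fin_one_eq_zero i]
    exact h
  | succ n ih =>
    simp only [walkSet, Finset.mem_biUnion, Finset.mem_filter, Finset.mem_image]
    constructor
    · rintro ⟨s, ⟨hs, hsK⟩, w', hw', rfl⟩
      obtain ⟨h0, h1, h2⟩ := ih.1 hw'
      refine ⟨rfl, Fin.cases ?_ fun i => ?_, Fin.cases ?_ fun i => ?_⟩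
      · simpa [h0] using hs
      · simpa using h1 i
      · simpa [h0] using hsK
      · simpa using h2 i
    · rintro ⟨h0, h1, h2⟩
      refine ⟨w 1 - w 0, ⟨h1 0, ?_⟩, Fin.tail w, ih.2 ⟨?_, fun i => h1 i.succ, fun i => h2 i.succ⟩,
        ?_⟩
      · have := h2 0
        simpa [← h0] using this
      · simp [← h0, Fin.tail]
      · rw [← h0, Fin.cons_self_tail]

theorem sum_walkSet_succ {M : Type*} [AddCommMonoid M] (n : ℕ) (p : ℤ × ℤ)
    (φ : (Fin (n + 2) → ℤ × ℤ) → M) : ∑ w ∈ walkSet K (n + 1) p, φ w =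
      ∑ s ∈ latticeSteps,
        Kᶜ.indicator (fun r => ∑ w ∈ walkSet K n r, φ (Fin.cons p w)) (p + s) := by
  classical
  rw [walkSet, Finset.sum_biUnion, Finset.sum_filter]
  · refine Finset.sum_congr rfl fun s _ => ?_
    rw [Finset.sum_image (fun a _ b _ h => Fin.cons_right_injective (α := fun _ => ℤ × ℤ) p h)]
    by_cases h : p + s ∈ K <;> simp [h]
  · intro s _ s' _ hss
    rw [Function.onFun, Finset.disjoint_left]
    intro w hw hw'
    obtain ⟨a, ha, rfl⟩ := Finset.mem_image.1 hw
    obtain ⟨b, hb, hab⟩ := Finset.mem_image.1 hw'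
    have e := Fin.cons_right_injective (α := fun _ => ℤ × ℤ) p hab
    subst e
    exact hss (add_left_cancel ((mem_walkSet.1 ha).1.symm.trans (mem_walkSet.1 hb).1))

theorem sum_walkSet_last (f : ℤ × ℤ → ℝ) (n : ℕ) (p : ℤ × ℤ) :
    ∑ w ∈ walkSet K n p, f (w (Fin.last n)) = avoidCount K f n p := by
  induction n generalizing p with
  | zero => simp [walkSet, avoidCount]
  | succ n ih =>
    rw [sum_walkSet_succ, avoidCount]
    refine Finset.sum_congr rfl fun s _ => ?_
    congr 1
    ext r
    rw [← ih r]
    simp only [← Fin.succ_last, Fin.cons_succ]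

theorem card_walkSet (n : ℕ) (p : ℤ × ℤ) : ((walkSet K n p).card : ℝ) = avoidCount K 1 n p := by
  rw [← sum_walkSet_last]
  simp

theorem slitWalks_eq (n : ℕ) : slitWalks n = walkSet halfAxis n (0, 0) := by
  ext w
  rw [mem_walkSet, slitWalks, Set.Finite.mem_toFinset]
  exact ⟨fun h => ⟨IsSlitWalk.start h, IsSlitWalk.step h, IsSlitWalk.avoid h⟩, fun h => ⟨h.1, h.2.1, h.2.2⟩⟩

theorem walkCount_eq (i j : ℤ) (n : ℕ) :
    (walkCount i j n : ℝ) = coeff n (green halfAxis (0, 0) (i, j)) := by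
  rw [green, coeff_avoidGF, ← sum_walkSet_last, walkCount, slitWalks_eq, Finset.card_filter]
  push_cast
  exact Finset.sum_congr rfl fun w _ => by simp [Pi.single_apply]

theorem card_slitWalks (n : ℕ) : ((slitWalks n).card : ℝ) = coeff n totalGF := by
  rw [slitWalks_eq, card_walkSet, totalGF, coeff_avoidGF]

theorem visits_cons (z p : ℤ × ℤ) {n : ℕ} (w : Fin (n + 1) → ℤ × ℤ) :
    visits z (Fin.cons p w : Fin (n + 2) → ℤ × ℤ) = (if p = z then 1 else 0) + visits z w := by
  simp only [visits, Finset.card_filter]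
  rw [Fin.sum_univ_succ]
  simp

/-- Each visit to z splits the walk into a walk from p to z and an arbitrary continuation from z. -/
theorem sum_visits (z p : ℤ × ℤ) (n : ℕ) : ∑ w ∈ walkSet K n p, (visits z w : ℝ) =
    coeff n (green K p z * avoidGF K 1 z) := by
  induction n generalizing p with
  | zero =>
    by_cases h : p = z <;> simp [walkSet, visits, green, avoidGF, avoidCount, h]
  | succ n ih =>
    have e2 : green K p z = PowerSeries.C ((Pi.single z 1 : ℤ × ℤ → ℝ) p) +
      X * ∑ s ∈ latticeSteps, Kᶜ.indicator (fun p => green K p z) (p + s) := avoidGF_eq p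
    rw [e2, add_mul, mul_assoc X, map_add, coeff_C_mul, coeff_succ_X_mul, Finset.sum_mul, map_sum]
    have e3 (w : Fin (n + 2) → ℤ × ℤ) (hw : w ∈ walkSet K (n + 1) p) : (visits z w : ℝ) =
        (if p = z then 1 else 0) + visits z (Fin.tail w) := by
      have h0 := (mem_walkSet.1 hw).1
      conv_lhs => rw [← Fin.cons_self_tail w, h0, visits_cons]
      push_cast
      rfl
    rw [Finset.sum_congr rfl e3, Finset.sum_add_distrib, Finset.sum_const, nsmul_eq_mul,
      card_walkSet, coeff_avoidGF]
    congr 1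
    · by_cases h : p = z
      · subst h; simp
      · simp [h]
    · rw [sum_walkSet_succ]
      refine Finset.sum_congr rfl fun s _ => ?_
      by_cases h : p + s ∈ K
      · simp [h]
      · simp only [Set.mem_compl_iff, h, not_false_eq_true, Set.indicator_of_mem]
        rw [← ih (p + s)]
        simp

theorem averageVisits_eq (z : ℤ × ℤ) (n : ℕ) : averageVisits z n =
    coeff n (green halfAxis (0, 0) z * avoidGF halfAxis 1 z) / coeff n totalGF := by
  rw [averageVisits, card_slitWalks, slitWalks_eq, sum_visits]

/-- Cutting at the last visit counts each visiting walk once; the remaining walks are those avoiding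
z as well as the half-axis. -/
theorem visitProportion_eq {z : ℤ × ℤ} (hz : z ∉ halfAxis) (n : ℕ) : visitProportion z n =
    coeff n (green halfAxis (0, 0) z * avoidGF (insert z halfAxis) 1 z) / coeff n totalGF := by
  have h0 : ((0, 0) : ℤ × ℤ) ≠ z := by
    rintro rfl
    simp [halfAxis] at hz
  rw [visitProportion, card_slitWalks]
  congr 1
  have h := avoidGF_insert (f := 1) hz (0, 0)
  rw [if_neg h0, ← totalGF] at h
  have h1 : green halfAxis (0, 0) z * avoidGF (insert z halfAxis) 1 z =
    totalGF - avoidGF (insert z halfAxis) 1 (0, 0) := by rw [h]; ring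
  rw [h1, map_sub, ← card_slitWalks, coeff_avoidGF, ← card_walkSet, eq_sub_iff_add_eq]
  have h2 : (slitWalks n).filter (fun w => ¬ ∃ i, w i = z) =
      walkSet (insert z halfAxis) n (0, 0) := by
    ext w
    rw [Finset.mem_filter, slitWalks_eq, mem_walkSet, mem_walkSet]
    simp only [not_exists, Set.mem_insert_iff, not_or]
    constructor
    · rintro ⟨⟨a, b, c⟩, d⟩
      exact ⟨a, b, fun i => ⟨d _, c i⟩⟩
    · rintro ⟨a, b, c⟩
      refine ⟨⟨a, b, fun i => (c i).2⟩, Fin.cases ?_ fun i => (c i).1⟩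
      rw [a]
      exact h0
  rw [← h2]
  exact_mod_cast Finset.card_filter_add_card_filter_not (s := slitWalks n) (fun w => ∃ i, w i = z)

end SlitPlane

/-! ### Explicit series for endpoints on the axis and for loops -/

namespace SlitPlane
open PowerSeries Finset.HasAntidiagonal

theorem coeff_T_mul (m i : ℤ) (F : LaurentPolynomial ℝ) :
    (LaurentPolynomial.T m * F).coeff i = F.coeff (i - m) := by
  have := AddMonoidAlgebra.coeff_single_mul_add F (1 : ℝ) m (i - m)
  rw [add_sub_cancel, one_mul] at this
  exact this

theorem coeff_laurent_add (n : ℕ) (i : ℤ) (F G : (LaurentPolynomial ℝ)⟦X⟧) :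
    (coeff n (F + G)).coeff i = (coeff n F).coeff i + (coeff n G).coeff i := by
  rw [map_add, AddMonoidAlgebra.coeff_add, Finsupp.add_apply]

theorem laurent_one_coeff (i : ℤ) :
    (1 : LaurentPolynomial ℝ).coeff i = if i = 0 then 1 else 0 := by
  rw [← map_one LaurentPolynomial.C, LaurentPolynomial.C_apply]

theorem coeff_zLaurent_mul (n : ℕ) (i : ℤ) (F : (LaurentPolynomial ℝ)⟦X⟧) :
    (coeff n (zLaurent * F)).coeff i = (coeff n F).coeff (i - 1) + (coeff n F).coeff (i + 1) := by
  rw [zLaurent, add_mul, coeff_laurent_add, coeff_C_mul, coeff_C_mul,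
    coeff_T_mul, coeff_T_mul, sub_neg_eq_add]

theorem coeff_axisLaurent (n : ℕ) (i : ℤ) : (coeff n axisLaurent).coeff i =
    if 0 ≤ i then (coeff n axisSeries).coeff i.toNat else 0 := coeff_map_toLaurent _ _ _

theorem axisSeries_coeff_zero (n : ℕ) :
    (coeff n axisSeries).coeff 0 = if n = 0 then 1 else 0 := by
  have h := congrArg (coeff n) axisSeries_eval_zero
  rw [coeff_map, coeff_one] at h
  rw [← h, Polynomial.coeff_zero_eq_aeval_zero]
  rfl

theorem coeff_axisLaurent_of_nonpos (n : ℕ) {i : ℤ} (hi : i ≤ 0) :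
    (coeff n axisLaurent).coeff i = if n = 0 ∧ i = 0 then 1 else 0 := by
  rw [coeff_axisLaurent]
  rcases hi.lt_or_eq with h | rfl
  · rw [if_neg (by omega), if_neg (by omega)]
  · simp [axisSeries_coeff_zero]

theorem coeff_two_mul (n : ℕ) (i : ℤ) (F : (LaurentPolynomial ℝ)⟦X⟧) :
    (coeff n (2 * F)).coeff i = 2 * (coeff n F).coeff i := by
  rw [two_mul, coeff_laurent_add, two_mul]

/-- The series T l^|j| satisfies the last-step recurrence at height j: for j ≠ 0 by the quadratic
equation for l, for j = 0 by the equation for T, whose correction N has no positive power of x. On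
the half-axis T has only its initial constant 1, so both sides vanish after time 0. -/
theorem avoidCount_halfAxis_eq {l N : (LaurentPolynomial ℝ)⟦X⟧} (h0 : constantCoeff l = 0)
    (hl : l = X * (zLaurent * l + 1 + l ^ 2))
    (hN : axisLaurent = X * (zLaurent * axisLaurent + 2 * (axisLaurent * l)) + N)
    (hN0 : ∀ n i, 0 < i → (coeff n N).coeff i = 0) (n : ℕ) (i j : ℤ) :
    avoidCount halfAxis (Pi.single (i, j) 1) n (0, 0) =
      (coeff n (axisLaurent * l ^ j.natAbs)).coeff i := by
  induction n generalizing i j with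
  | zero =>
    rw [coeff_zero_eq_constantCoeff_apply, map_mul, map_pow, h0]
    have hc : constantCoeff axisLaurent = 1 := by
      have := constantCoeff_map' (Polynomial.toLaurent : Polynomial ℝ →+* LaurentPolynomial ℝ)
        axisSeries
      rw [constantCoeff_axisSeries, map_one] at this
      exact this
    rw [hc, one_mul]
    by_cases hj : j = 0
    · subst hj
      by_cases hi : i = 0
      · subst hi; simp [avoidCount]
      · have : ((0, 0) : ℤ × ℤ) ≠ (i, 0) := by simpa using Ne.symm hi
        simp [avoidCount, laurent_one_coeff, hi, this]
    · have : ((0, 0) : ℤ × ℤ) ≠ (i, j) := fun h => hj (by simpa using (congrArg Prod.snd h).symm)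
      simp [avoidCount, hj, this]
  | succ n ih =>
    rw [avoidCount_succ_single]
    by_cases hij : (i, j) ∈ halfAxis
    · have hij' := hij
      obtain ⟨hi, rfl⟩ : i ≤ 0 ∧ j = 0 := hij
      simp [hij', coeff_axisLaurent_of_nonpos _ hi]
    · simp only [hij, Set.mem_compl_iff, not_false_eq_true, Set.indicator_of_mem]
      rw [latticeSteps, Finset.sum_insert (by simp), Finset.sum_insert (by simp),
        Finset.sum_insert (by simp), Finset.sum_singleton]
      simp only [Prod.mk_sub_mk, sub_zero, sub_neg_eq_add, ih]
      by_cases hj : j = 0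
      · subst hj
        have hi : 0 < i := by
          by_contra hi
          exact hij ⟨not_lt.1 hi, rfl⟩
        have e := congrArg (fun F : (LaurentPolynomial ℝ)⟦X⟧ => (coeff (n + 1) F).coeff i) hN
        simp only [coeff_laurent_add, coeff_succ_X_mul, hN0 _ _ hi, coeff_zLaurent_mul,
          coeff_two_mul] at e
        simp only [Int.natAbs_zero, pow_zero, mul_one]
        rw [e]
        simp
        ring
      · obtain ⟨m, hm⟩ : ∃ m, j.natAbs = m + 1 := ⟨j.natAbs - 1, by omega⟩
        have e : axisLaurent * l ^ (m + 1) = X * (zLaurent * (axisLaurent * l ^ (m + 1)) +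
            (axisLaurent * l ^ m + axisLaurent * l ^ (m + 2))) := by
          linear_combination axisLaurent * l ^ m * hl
        have e' := congrArg (fun F : (LaurentPolynomial ℝ)⟦X⟧ => (coeff (n + 1) F).coeff i) e
        simp only [coeff_laurent_add, coeff_succ_X_mul, coeff_zLaurent_mul] at e'
        rw [hm, e']
        rcases lt_or_gt_of_ne hj with h | h
        · rw [show (j - 1).natAbs = m + 2 by omega, show (j + 1).natAbs = m by omega]
          ring
        · rw [show (j - 1).natAbs = m by omega, show (j + 1).natAbs = m + 2 by omega]
          ring

theorem coeff_slitGF (n l : ℕ) : coeff n (slitGF l) = (coeff n axisSeries).coeff l := by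
  obtain ⟨q, hq⟩ := exists_inv_cat_mul_catNeg
  obtain ⟨r, N, h0, hl, hN, hN0, -⟩ := exists_kernel_factorization q hq
  rw [slitGF, green, coeff_avoidGF, avoidCount_halfAxis_eq h0 hl hN hN0]
  simp [coeff_axisLaurent]

/-- The x⁰ coefficient of the equation for T identifies q with 1 minus the series of first returns
to the origin, and E is the inverse of the latter. -/
theorem loopGF_eq : loopGF = cat * catNeg := by
  obtain ⟨q, hq⟩ := exists_inv_cat_mul_catNeg
  obtain ⟨r, N, h0, hl, hN, hN0, hNq⟩ := exists_kernel_factorization q hq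
  have key : 1 - X * (green halfAxis (0, 0) (1, 0) +
      green halfAxis (0, 0) (0, 1) + green halfAxis (0, 0) (0, -1)) = q := by
    ext n
    have e := congrArg (fun F : (LaurentPolynomial ℝ)⟦X⟧ => (coeff n F).coeff 0) hN
    simp only [coeff_laurent_add, hNq,
      coeff_axisLaurent_of_nonpos n le_rfl, and_true] at e
    rw [map_sub, coeff_one, e]
    rcases n with _ | n
    · simp
    · rw [coeff_succ_X_mul, coeff_succ_X_mul, map_add, map_add, map_add,
        AddMonoidAlgebra.coeff_add, Finsupp.add_apply, coeff_zLaurent_mul, coeff_two_mul,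
        coeff_axisLaurent_of_nonpos n (by norm_num)]
      simp only [green, coeff_avoidGF, avoidCount_halfAxis_eq h0 hl hN hN0]
      simp
      ring
  have h := loopGF_mul
  rw [key] at h
  linear_combination (cat * catNeg) * h - loopGF * hq

/-- Exchange of the variables in a power series with polynomial coefficients. -/
noncomputable def swapVar (g : (Polynomial ℝ)⟦X⟧) : ℝ⟦X⟧⟦X⟧ :=
  PowerSeries.mk fun l => PowerSeries.mk fun n => (coeff n g).coeff l

theorem coeff_swapVar (g : (Polynomial ℝ)⟦X⟧) (l n : ℕ) :
    coeff n (coeff l (swapVar g)) = (coeff n g).coeff l := by simp [swapVar]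

theorem swapVar_mul (g h : (Polynomial ℝ)⟦X⟧) : swapVar (g * h) = swapVar g * swapVar h := by
  ext l n
  rw [coeff_swapVar, coeff_mul, coeff_mul, Polynomial.finsetSum_coeff, map_sum]
  simp only [coeff_mul, Polynomial.coeff_mul, coeff_swapVar]
  rw [Finset.sum_comm]

theorem swapVar_sub (g h : (Polynomial ℝ)⟦X⟧) : swapVar (g - h) = swapVar g - swapVar h := by
  ext l n
  simp [coeff_swapVar]

theorem swapVar_one : swapVar 1 = 1 := by
  ext l n
  rw [coeff_swapVar, coeff_one, coeff_one]
  by_cases hn : n = 0 <;> by_cases hl : l = 0 <;> simp [hn, hl, Polynomial.coeff_one, coeff_one]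

theorem swapVar_X : swapVar (PowerSeries.C Polynomial.X) = X := by
  ext l n
  rw [coeff_swapVar, coeff_C, coeff_X]
  by_cases hn : n = 0 <;> by_cases hl : l = 1 <;>
    simp [hn, hl, Polynomial.coeff_X, coeff_one, eq_comm]

theorem swapVar_map (f : ℝ⟦X⟧) :
    swapVar (PowerSeries.map (algebraMap ℝ (Polynomial ℝ)) f) = PowerSeries.C f := by
  ext l n
  rw [coeff_swapVar, coeff_C, coeff_map]
  by_cases hl : l = 0 <;> simp [hl, Polynomial.coeff_C]

/-- Viewed as a series in x, `axisSeries` is the product of (1 - xu)^(-1/2) and (1 - xv)^(-1/2),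
both having constant term 1; extract the coefficient of x^l. -/
theorem slitGF_eq (l : ℕ) : slitGF l = ∑ x ∈ antidiagonal l,
    PowerSeries.C (halfCoeff x.1 * halfCoeff x.2) * ((cat - 1) ^ x.1 * (1 - catNeg) ^ x.2) := by
  set φ : ℝ⟦X⟧ → ℝ⟦X⟧⟦X⟧ := fun u => rescale u (PowerSeries.map (algebraMap ℝ ℝ⟦X⟧) halfSeries)
    with hφ
  have hφ2 (u : ℝ⟦X⟧) : φ u ^ 2 * (1 - X * PowerSeries.C u) = 1 := by
    have := congrArg (fun f => rescale u (PowerSeries.map (algebraMap ℝ ℝ⟦X⟧) f)) halfSeries_sq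
    simp only [map_mul, map_pow, map_sub, map_one, map_X, rescale_X] at this
    rw [mul_comm X]
    exact this
  have hφc (u : ℝ⟦X⟧) (n : ℕ) : coeff n (φ u) = u ^ n * PowerSeries.C (halfCoeff n) := by
    simp [hφ, halfSeries, coeff_rescale]
  have hs := congrArg swapVar axisSeries_sq
  rw [sq, swapVar_mul, swapVar_mul, deltaFactor, swapVar_mul, swapVar_sub, swapVar_sub,
    swapVar_mul, swapVar_mul, swapVar_sub, swapVar_sub, swapVar_map, swapVar_map, swapVar_one,
    swapVar_X] at hs
  have h1 := hφ2 (cat - 1)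
  have h2 := hφ2 (1 - catNeg)
  rw [map_sub, map_one] at h1 h2
  have key : swapVar axisSeries = φ (cat - 1) * φ (1 - catNeg) := by
    refine eq_of_sq_eq_sq ?_ ?_ ?_
    · ext n
      rw [← coeff_zero_eq_constantCoeff_apply, coeff_swapVar, axisSeries_coeff_zero, coeff_one]
    · rw [← coeff_zero_eq_constantCoeff_apply, coeff_mul]
      simp [hφc, halfCoeff_zero]
    · generalize swapVar axisSeries = g at *
      generalize φ (cat - 1) = a at *
      generalize φ (1 - catNeg) = b at *
      set d₁ := (1 - X * (PowerSeries.C cat - 1) : ℝ⟦X⟧⟦X⟧)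
      set d₂ := (1 - X * (1 - PowerSeries.C catNeg) : ℝ⟦X⟧⟦X⟧)
      linear_combination a ^ 2 * b ^ 2 * hs - g ^ 2 * b ^ 2 * d₂ * h1 - g ^ 2 * h2
  have h3 : slitGF l = coeff l (swapVar axisSeries) := by
    ext n
    rw [coeff_slitGF, coeff_swapVar]
  rw [h3, key, coeff_mul]
  refine Finset.sum_congr rfl fun x _ => ?_
  rw [hφc, hφc, map_mul]
  ring

end SlitPlane

/-! ### The series of all slit walks -/

namespace SlitPlane
open PowerSeries Finset.HasAntidiagonal

theorem avoidCount_one_of_lt (n : ℕ) (p : ℤ × ℤ) (h : (n : ℤ) < p.1) :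
    avoidCount halfAxis 1 n p = 4 ^ n := by
  induction n generalizing p with
  | zero => simp [avoidCount]
  | succ n ih =>
    have hs : ∀ s ∈ latticeSteps, halfAxisᶜ.indicator (avoidCount halfAxis 1 n) (p + s) = 4 ^ n := by
      intro s hs
      have h1 : -1 ≤ s.1 := by
        simp only [latticeSteps, Finset.mem_insert, Finset.mem_singleton] at hs
        rcases hs with rfl | rfl | rfl | rfl <;> simp
      have h2 : (n : ℤ) < (p + s).1 := by
        push_cast at h
        rw [Prod.fst_add]
        omega
      have h3 : p + s ∉ halfAxis := fun h3 => by
        have := h3.1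
        omega
      rw [Set.indicator_of_mem h3, ih _ h2]
    rw [avoidCount, Finset.sum_congr rfl hs, Finset.sum_const, show latticeSteps.card = 4 from rfl,
      nsmul_eq_mul, pow_succ]
    push_cast
    ring

/-- The series `∑ₗ S_{l,0}`. -/
noncomputable def axisTotal : ℝ⟦X⟧ :=
  PowerSeries.map ((Polynomial.aeval (1 : ℝ) : Polynomial ℝ →ₐ[ℝ] ℝ) : Polynomial ℝ →+* ℝ)
    axisSeries

theorem coeff_axisTotal (n k : ℕ) (hk : (coeff n axisSeries).natDegree < k) :
    coeff n axisTotal = coeff n (∑ l ∈ Finset.range k, slitGF l) := by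
  rw [map_sum, axisTotal, coeff_map]
  simp only [coeff_slitGF]
  have := Polynomial.eval_eq_sum_range' hk (1 : ℝ)
  simpa using this

theorem totalGF_mul_axisTotal :
    totalGF * loopGF * axisTotal = PowerSeries.mk fun n => (4 : ℝ) ^ n := by
  ext n
  -- Choose k beyond n, so that the half-axis is out of reach from (k,0), and beyond all degrees in
  -- x up to order n, so that the truncated sum of the S_l already agrees with `axisTotal`.
  obtain ⟨k, hk⟩ : ∃ k, ∀ m ∈ Finset.range (n + 1), max m (coeff m axisSeries).natDegree < k :=
    ⟨(Finset.range (n + 1)).sup (fun m => max m (coeff m axisSeries).natDegree) + 1, fun m hm =>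
      Nat.lt_succ_of_le (Finset.le_sup (f := fun m => max m (coeff m axisSeries).natDegree) hm)⟩
  have hnk : n < k := lt_of_le_of_lt (le_max_left _ _) (hk n (by simp))
  have h1 := congrArg (coeff n) (totalGF_from (k := k) (by omega))
  rw [coeff_avoidGF, avoidCount_one_of_lt n _ (by simpa using hnk)] at h1
  rw [coeff_mk, h1, coeff_mul, coeff_mul]
  refine Finset.sum_congr rfl fun x hx => ?_
  rw [coeff_axisTotal x.2 k]
  have := Finset.HasAntidiagonal.mem_antidiagonal.1 hx
  exact lt_of_le_of_lt (le_max_right _ _) (hk x.2 (by simp; omega))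

theorem totalGF_kernel : totalGF * (cat * catNeg) * axisTotal * (1 - 4 * X) = 1 := by
  rw [← loopGF_eq, totalGF_mul_axisTotal]
  ext n
  rw [mul_sub, mul_one, show (4 * X : ℝ⟦X⟧) = PowerSeries.C 4 * X by rw [map_ofNat], ← mul_assoc,
    mul_comm _ (PowerSeries.C 4), mul_assoc, map_sub, coeff_C_mul, coeff_one]
  rcases n with _ | n
  · simp
  · simp [coeff_succ_mul_X, pow_succ']

theorem axisTotal_sq : axisTotal ^ 2 * ((2 - cat) * catNeg) = 1 := by
  have h := congrArg (PowerSeries.map ((Polynomial.aeval (1 : ℝ) : Polynomial ℝ →ₐ[ℝ] ℝ) :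
    Polynomial ℝ →+* ℝ)) axisSeries_sq
  rw [map_mul, map_pow, map_deltaFactor, ← axisTotal] at h
  have h1 : deltaFactor ((Polynomial.aeval (1 : ℝ) : Polynomial ℝ →ₐ[ℝ] ℝ) Polynomial.X) =
      (2 - cat) * catNeg := by
    simp [deltaFactor]
    left
    ring
  rw [h1, map_one] at h
  exact h

theorem totalGF_pow : totalGF ^ 4 * (1 - 4 * X) ^ 3 * (cat * catNeg) ^ 2 = 1 := by
  have h1 := totalGF_kernel
  have h2 := axisTotal_sq
  have h3 : (2 - cat) ^ 2 = cat ^ 2 * (1 - 4 * X) := by linear_combination -4 * cat_eq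
  set w : ℝ⟦X⟧ := 1 - 4 * X
  have h4 : axisTotal ^ 4 * (cat ^ 2 * w) * catNeg ^ 2 = 1 := by
    rw [← h3]
    linear_combination (axisTotal ^ 2 * ((2 - cat) * catNeg) + 1) * h2
  have h5 : (totalGF * (cat * catNeg) * axisTotal * w) ^ 4 = 1 := by rw [h1, one_pow]
  calc totalGF ^ 4 * w ^ 3 * (cat * catNeg) ^ 2 = totalGF ^ 4 * w ^ 3 * (cat * catNeg) ^ 2 *
      (axisTotal ^ 4 * (cat ^ 2 * w) * catNeg ^ 2) := by rw [h4, mul_one]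
    _ = (totalGF * (cat * catNeg) * axisTotal * w) ^ 4 := by ring
    _ = 1 := h5

/-- With y = tC and e = 1 - C^(-1/2), one has y = t + y² and 2e = y + e². Inductively 0 ≤ e ≤ y
coefficientwise, since 2e ≤ y + y² ≤ 2y. The bound transfers weighted summability from C to
C^(-1/2). -/
theorem exists_sqrt_inv_cat : ∃ g : ℝ⟦X⟧, constantCoeff g = 1 ∧ g ^ 2 * cat = 1 ∧
    ∀ n, |coeff n g| ≤ coeff n (1 + X * cat) := by
  obtain ⟨g, hg0, hg⟩ := exists_inv_sqrt constantCoeff_cat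
  refine ⟨g, hg0, hg, ?_⟩
  set e := 1 - g with he
  set y := X * cat with hy
  have hy2 : y = X + y ^ 2 := by
    rw [hy]
    linear_combination X * cat_eq
  have hge : g ^ 2 = 1 - y := by
    linear_combination (1 - X * cat) * hg - g ^ 2 * cat_eq
  have h2e : e + e = y + e ^ 2 := by
    rw [he]
    linear_combination -hge
  have hy0 : ∀ n, 0 ≤ coeff n y := by
    intro n
    rcases n with _ | n
    · simp [hy]
    · rw [hy, coeff_succ_X_mul]
      simp [cat]
  have hbound : ∀ n, 0 ≤ coeff n e ∧ coeff n e ≤ coeff n y := by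
    intro n
    induction n using Nat.strong_induction_on with
    | _ n ih =>
      rcases n.eq_zero_or_pos with rfl | hn
      · simp [he, hy, hg0]
      · have e0 : coeff 0 e = 0 := by simp [he, hg0]
        have y0 : coeff 0 y = 0 := by simp [hy]
        have h1 : ∀ x ∈ antidiagonal n, 0 ≤ coeff x.1 e * coeff x.2 e ∧
            coeff x.1 e * coeff x.2 e ≤ coeff x.1 y * coeff x.2 y := by
          rintro ⟨a, b⟩ hx
          have hx' := Finset.HasAntidiagonal.mem_antidiagonal.1 hx
          simp only at hx' ⊢
          rcases a.eq_zero_or_pos with rfl | ha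
          · simp [e0, y0]
          · rcases b.eq_zero_or_pos with rfl | hb
            · simp [e0, y0]
            · have i1 := ih a (by omega)
              have i2 := ih b (by omega)
              exact ⟨mul_nonneg i1.1 i2.1, mul_le_mul i1.2 i2.2 i2.1 (hy0 _)⟩
        have h3 : coeff n e + coeff n e = coeff n y + coeff n (e ^ 2) := by
          rw [← map_add, ← map_add, h2e]
        have h4 : coeff n (e ^ 2) ≤ coeff n (y ^ 2) := by
          rw [sq, sq, coeff_mul, coeff_mul]
          exact Finset.sum_le_sum fun x hx => (h1 x hx).2
        have h5 : 0 ≤ coeff n (e ^ 2) := by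
          rw [sq, coeff_mul]
          exact Finset.sum_nonneg fun x hx => (h1 x hx).1
        have h6 : coeff n y = coeff n X + coeff n (y ^ 2) := by
          rw [← map_add, ← hy2]
        have h7 : (0 : ℝ) ≤ coeff n (X : ℝ⟦X⟧) := by
          rw [coeff_X]; positivity
        have := hy0 n
        constructor <;> linarith
  intro n
  have h1 : g = 1 - e := by rw [he]; ring
  have h2 : (0 : ℝ) ≤ coeff n (1 : ℝ⟦X⟧) := by
    rw [coeff_one]; positivity
  have := hbound n
  rw [h1, map_sub, map_add, abs_le]
  constructor <;> linarith

theorem totalGF_eq {g h : ℝ⟦X⟧} (hg0 : constantCoeff g = 1) (hh0 : constantCoeff h = 1)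
    (hg : g ^ 2 * cat = 1) (hh : h ^ 2 * catNeg = 1) : totalGF = g * h * quartSeries := by
  have h0 : constantCoeff totalGF = 1 := by
    rw [← coeff_zero_eq_constantCoeff_apply, totalGF, coeff_avoidGF]
    simp [avoidCount]
  have hq0 : constantCoeff quartSeries = 1 := by
    simp [quartSeries, quartCoeff_zero]
  refine eq_of_sq_eq_sq h0 (by simp [hg0, hh0, hq0]) (eq_of_sq_eq_sq (by simp [h0])
    (by simp [hg0, hh0, hq0]) ?_)
  have h1 := totalGF_pow
  have h2 := quartSeries_pow
  set w : ℝ⟦X⟧ := 1 - 4 * X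
  have h3 : (g * h) ^ 4 * (cat * catNeg) ^ 2 = 1 := by
    calc _ = (g ^ 2 * cat) ^ 2 * (h ^ 2 * catNeg) ^ 2 := by ring
      _ = 1 := by rw [hg, hh]; ring
  linear_combination (g * h * quartSeries) ^ 4 * h1 - totalGF ^ 4 * (g * h) ^ 4 *
    (cat * catNeg) ^ 2 * h2 - totalGF ^ 4 * h3

end SlitPlane

/-! ### Weighted summability, evaluation at 1/4, and coefficient asymptotics -/

namespace SlitPlane
open PowerSeries Finset.HasAntidiagonal Filter Topology

/-- Summability of the coefficients at `1 / 4`, with the submultiplicative weight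
`1 / quartCoeff n`. -/
def WeightedSummable (f : ℝ⟦X⟧) : Prop :=
  Summable fun n => |coeff n f| * (1 / 4) ^ n / quartCoeff n

/-- The sum of a power series at `1 / 4`. -/
noncomputable def quarterSum (f : ℝ⟦X⟧) : ℝ := ∑' n, coeff n f * (1 / 4) ^ n

theorem quartCoeff_le_one (n : ℕ) : quartCoeff n ≤ 1 :=
  Finset.prod_le_one (fun i _ => by positivity) fun i _ => by
    rw [div_le_one (by positivity)]; linarith

variable {f g : ℝ⟦X⟧}

theorem WeightedSummable.summable_abs (hf : WeightedSummable f) :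
    Summable fun n => |coeff n f * (1 / 4) ^ n| := by
  refine Summable.of_nonneg_of_le (fun n => abs_nonneg _) (fun n => ?_) hf
  rw [abs_mul, abs_of_pos (by positivity : (0 : ℝ) < (1 / 4) ^ n)]
  rw [le_div_iff₀ (quartCoeff_pos n)]
  exact mul_le_of_le_one_right (by positivity) (quartCoeff_le_one n)

theorem WeightedSummable.summable (hf : WeightedSummable f) :
    Summable fun n => coeff n f * (1 / 4) ^ n := hf.summable_abs.of_abs

theorem WeightedSummable.of_abs_le (hg : WeightedSummable g)
    (h : ∀ n, |coeff n f| ≤ coeff n g) : WeightedSummable f := by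
  refine Summable.of_nonneg_of_le (fun n => by have := quartCoeff_pos n; positivity)
    (fun n => ?_) hg
  have := quartCoeff_pos n
  have := (h n).trans (le_abs_self _)
  gcongr

theorem weightedSummable_polynomial (p : Polynomial ℝ) : WeightedSummable (p : ℝ⟦X⟧) := by
  refine summable_of_ne_finset_zero (s := p.support) fun n hn => ?_
  rw [Polynomial.coeff_coe, Polynomial.notMem_support_iff.1 hn]
  simp

theorem weightedSummable_C (r : ℝ) : WeightedSummable (PowerSeries.C r) := by
  simpa using weightedSummable_polynomial (Polynomial.C r)

theorem weightedSummable_one : WeightedSummable 1 := by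
  simpa using weightedSummable_C 1

theorem weightedSummable_X : WeightedSummable X := by
  simpa using weightedSummable_polynomial Polynomial.X

theorem WeightedSummable.add (hf : WeightedSummable f) (hg : WeightedSummable g) :
    WeightedSummable (f + g) := by
  refine Summable.of_nonneg_of_le (fun n => by have := quartCoeff_pos n; positivity)
    (fun n => ?_) (Summable.add hf hg)
  have := quartCoeff_pos n
  rw [← add_div, ← add_mul, map_add]
  gcongr
  exact abs_add_le _ _

theorem WeightedSummable.neg (hf : WeightedSummable f) : WeightedSummable (-f) := by
  simpa [WeightedSummable] using hf

theorem WeightedSummable.sub (hf : WeightedSummable f) (hg : WeightedSummable g) :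
    WeightedSummable (f - g) := by
  rw [sub_eq_add_neg]; exact hf.add hg.neg

theorem WeightedSummable.mul (hf : WeightedSummable f) (hg : WeightedSummable g) :
    WeightedSummable (f * g) := by
  have hf' : Summable fun n => ‖|coeff n f| * (1 / 4) ^ n / quartCoeff n‖ := Summable.norm hf
  have hg' : Summable fun n => ‖|coeff n g| * (1 / 4) ^ n / quartCoeff n‖ := Summable.norm hg
  have h := summable_norm_sum_mul_antidiagonal_of_summable_norm hf' hg'
  refine Summable.of_nonneg_of_le (fun n => by have := quartCoeff_pos n; positivity)
    (fun n => ?_) h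
  refine le_trans ?_ (le_abs_self _)
  rw [coeff_mul, mul_div_assoc]
  have := quartCoeff_pos n
  refine (mul_le_mul_of_nonneg_right (Finset.abs_sum_le_sum_abs _ _) (by positivity)).trans ?_
  rw [Finset.sum_mul]
  refine Finset.sum_le_sum fun x hx => ?_
  have hx' := Finset.HasAntidiagonal.mem_antidiagonal.1 hx
  have h1 := quartCoeff_pos x.1
  have h2 := quartCoeff_pos x.2
  have h3 := quartCoeff_mul_le x.1 x.2
  rw [hx'] at h3
  calc |coeff x.1 f * coeff x.2 g| * ((1 / 4) ^ n / quartCoeff n)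
      ≤ |coeff x.1 f * coeff x.2 g| * ((1 / 4) ^ n / (quartCoeff x.1 * quartCoeff x.2)) := by
        gcongr
    _ = _ := by
        rw [abs_mul, ← hx', pow_add]
        field_simp

theorem WeightedSummable.pow (hf : WeightedSummable f) (n : ℕ) : WeightedSummable (f ^ n) := by
  induction n with
  | zero => simpa using weightedSummable_one
  | succ n ih => rw [pow_succ]; exact ih.mul hf

theorem weightedSummable_sum {ι : Type*} (s : Finset ι) (F : ι → ℝ⟦X⟧)
    (h : ∀ i ∈ s, WeightedSummable (F i)) : WeightedSummable (∑ i ∈ s, F i) :=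
  Finset.sum_induction F WeightedSummable (fun _ _ => WeightedSummable.add)
    (by simpa using weightedSummable_C 0) h

theorem quarterSum_polynomial (p : Polynomial ℝ) : quarterSum (p : ℝ⟦X⟧) = p.eval (1 / 4) := by
  rw [quarterSum, tsum_eq_sum (s := p.support), Polynomial.eval_eq_sum, Polynomial.sum]
  · simp
  · intro n hn
    rw [Polynomial.coeff_coe, Polynomial.notMem_support_iff.1 hn, zero_mul]

theorem quarterSum_C (r : ℝ) : quarterSum (PowerSeries.C r) = r := by
  simpa using quarterSum_polynomial (Polynomial.C r)

theorem quarterSum_one : quarterSum 1 = 1 := by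
  simpa using quarterSum_C 1

theorem quarterSum_X : quarterSum X = 1 / 4 := by
  simpa using quarterSum_polynomial Polynomial.X

theorem quarterSum_add (hf : WeightedSummable f) (hg : WeightedSummable g) :
    quarterSum (f + g) = quarterSum f + quarterSum g := by
  rw [quarterSum, quarterSum, quarterSum, ← hf.summable.tsum_add hg.summable]
  exact tsum_congr fun n => by rw [map_add, add_mul]

theorem quarterSum_sub (hf : WeightedSummable f) (hg : WeightedSummable g) :
    quarterSum (f - g) = quarterSum f - quarterSum g := by
  rw [quarterSum, quarterSum, quarterSum, ← hf.summable.tsum_sub hg.summable]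
  exact tsum_congr fun n => by rw [map_sub, sub_mul]

theorem quarterSum_mul (hf : WeightedSummable f) (hg : WeightedSummable g) :
    quarterSum (f * g) = quarterSum f * quarterSum g := by
  have hf' : Summable fun n => ‖coeff n f * (1 / 4) ^ n‖ := hf.summable_abs
  have hg' : Summable fun n => ‖coeff n g * (1 / 4) ^ n‖ := hg.summable_abs
  rw [quarterSum, quarterSum, quarterSum,
    tsum_mul_tsum_eq_tsum_sum_antidiagonal_of_summable_norm hf' hg']
  refine tsum_congr fun n => ?_
  rw [coeff_mul, Finset.sum_mul]
  refine Finset.sum_congr rfl fun x hx => ?_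
  rw [← Finset.HasAntidiagonal.mem_antidiagonal.1 hx, pow_add]
  ring

theorem quarterSum_pow (hf : WeightedSummable f) (n : ℕ) :
    quarterSum (f ^ n) = quarterSum f ^ n := by
  induction n with
  | zero => simpa using quarterSum_one
  | succ n ih => rw [pow_succ, pow_succ, quarterSum_mul (hf.pow n) hf, ih]

theorem quarterSum_sum {ι : Type*} (s : Finset ι) (F : ι → ℝ⟦X⟧)
    (h : ∀ i ∈ s, WeightedSummable (F i)) :
    quarterSum (∑ i ∈ s, F i) = ∑ i ∈ s, quarterSum (F i) := by
  classical
  induction s using Finset.induction_on with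
  | empty => simp [quarterSum]
  | insert a s ha ih =>
    rw [Finset.sum_insert ha, Finset.sum_insert ha, quarterSum_add (h a (by simp))
      (weightedSummable_sum _ _ fun i hi => h i (by simp [hi])), ih fun i hi => h i (by simp [hi])]

theorem quartCoeff_sub_div_le (n i : ℕ) (hi : i ≤ n) :
    quartCoeff (n - i) / quartCoeff n ≤ 1 / quartCoeff i := by
  have h := quartCoeff_mul_le i (n - i)
  rw [Nat.add_sub_cancel' hi] at h
  rw [div_le_div_iff₀ (quartCoeff_pos _) (quartCoeff_pos _)]
  linarith

theorem tendsto_quartCoeff_div (i : ℕ) :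
    Tendsto (fun n => quartCoeff n / quartCoeff (n + i)) atTop (𝓝 1) := by
  induction i with
  | zero =>
    refine tendsto_const_nhds.congr fun n => ?_
    rw [add_zero, div_self (quartCoeff_pos n).ne']
  | succ i ih =>
    have h1 : Tendsto (fun n : ℕ => 1 - (1 / 4 : ℝ) * (1 / (((n + i : ℕ) : ℝ) + 1))) atTop
        (𝓝 (1 - 1 / 4 * 0)) :=
      ((tendsto_one_div_add_atTop_nhds_zero_nat.comp (tendsto_add_atTop_nat i)).const_mul _).const_sub _
    have h2 := ih.div h1 (by norm_num)
    norm_num only at h2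
    refine h2.congr fun n => ?_
    have := quartCoeff_pos (n + i)
    rw [Pi.div_apply, ← add_assoc, quartCoeff_succ]
    have h3 : (1 - (1 / 4 : ℝ) * (1 / (((n + i : ℕ) : ℝ) + 1))) =
        (4 * ((n + i : ℕ) : ℝ) + 3) / (4 * ((n + i : ℕ) : ℝ) + 4) := by
      field_simp
      ring
    rw [← h3, div_div]

/-- Each term of the normalized convolution tends to its value in f(1/4), because `quartCoeff` has
consecutive ratios tending to 1. Submultiplicativity of the weight bounds the i-th term, uniformly
in n, by the summand in `WeightedSummable`. -/
theorem tendsto_coeff_mul_quartSeries (hf : WeightedSummable f) :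
    Tendsto (fun n => coeff n (f * quartSeries) / (4 ^ n * quartCoeff n)) atTop
      (𝓝 (quarterSum f)) := by
  have key : ∀ n, coeff n (f * quartSeries) / (4 ^ n * quartCoeff n) =
      ∑' i, if i ≤ n then coeff i f * (1 / 4) ^ i * (quartCoeff (n - i) / quartCoeff n) else 0 := by
    intro n
    rw [tsum_eq_sum (s := Finset.range (n + 1))
      (fun i hi => if_neg (by simpa using hi)), coeff_mul,
      Finset.Nat.sum_antidiagonal_eq_sum_range_succ
        (fun i j => coeff i f * coeff j quartSeries), Finset.sum_div]
    refine Finset.sum_congr rfl fun i hi => ?_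
    have hi' : i ≤ n := by simpa [Nat.lt_succ_iff] using hi
    have := quartCoeff_pos n
    rw [if_pos hi', quartSeries, coeff_mk]
    have h4 : (4 : ℝ) ^ n = 4 ^ i * 4 ^ (n - i) := by rw [← pow_add, Nat.add_sub_cancel' hi']
    rw [h4, one_div, inv_pow]
    field_simp
  simp only [key]
  refine tendsto_tsum_of_dominated_convergence hf (fun i => ?_) (Eventually.of_forall fun n i => ?_)
  · have h := (tendsto_quartCoeff_div i).const_mul (coeff i f * (1 / 4) ^ i)
    rw [mul_one] at h
    refine ((tendsto_add_atTop_iff_nat i).1 ?_)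
    refine h.congr fun n => ?_
    rw [if_pos (by omega), Nat.add_sub_cancel]
  · have := quartCoeff_pos i
    split_ifs with h
    · have h1 := quartCoeff_sub_div_le n i h
      have h2 := quartCoeff_pos n
      have h3 := quartCoeff_pos (n - i)
      rw [Real.norm_eq_abs, abs_mul, abs_mul, abs_of_pos (by positivity : (0 : ℝ) < (1 / 4) ^ i),
        abs_of_pos (by positivity : 0 < quartCoeff (n - i) / quartCoeff n),
        div_eq_mul_one_div _ (quartCoeff i)]
      exact mul_le_mul_of_nonneg_left h1 (by positivity)
    · rw [norm_zero]
      positivity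

theorem catalan_eq (n : ℕ) : (catalan n : ℝ) = 4 ^ n * halfCoeff n / (n + 1) := by
  have h : ((n.centralBinom : ℕ) : ℝ) = 4 ^ n * halfCoeff n := by
    induction n with
    | zero => simp [halfCoeff_zero]
    | succ n ih =>
      have h1 : ((n : ℝ) + 1) * ((n + 1).centralBinom : ℝ) =
          2 * (2 * n + 1) * (n.centralBinom : ℝ) := by
        exact_mod_cast Nat.succ_mul_centralBinom_succ n
      rw [ih] at h1
      rw [halfCoeff_succ]
      field_simp
      rw [pow_succ]
      linear_combination 2 * h1
  have h2 : ((n : ℝ) + 1) * (catalan n : ℝ) = (n.centralBinom : ℝ) := by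
    exact_mod_cast succ_mul_catalan_eq_centralBinom n
  rw [h] at h2
  field_simp
  linarith

/-- The terms are dominated by 4(r_n - r_{n+1}) with r_n = `halfCoeff n / quartCoeff n`, which
telescopes to at most 4 r_0 = 4. -/
theorem weightedSummable_cat : WeightedSummable cat := by
  have hterm : ∀ n, |coeff n cat| * (1 / 4) ^ n / quartCoeff n ≤
      4 * (halfCoeff n / quartCoeff n - halfCoeff (n + 1) / quartCoeff (n + 1)) := by
    intro n
    have h1 := quartCoeff_pos n
    have h2 := halfCoeff_pos n
    rw [cat, coeff_mk, catalan_eq, abs_of_pos (by positivity), halfCoeff_succ, quartCoeff_succ,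
      one_div, inv_pow]
    have e1 : 4 ^ n * halfCoeff n / ((n : ℝ) + 1) * ((4 : ℝ) ^ n)⁻¹ / quartCoeff n =
        halfCoeff n / quartCoeff n * (1 / ((n : ℝ) + 1)) := by
      field_simp
    have e2 : 4 * (halfCoeff n / quartCoeff n - halfCoeff n * ((2 * (n : ℝ) + 1) / (2 * n + 2)) /
        (quartCoeff n * ((4 * n + 3) / (4 * n + 4)))) =
        halfCoeff n / quartCoeff n * (4 / (4 * n + 3)) := by
      field_simp
      ring
    rw [e1, e2]
    gcongr ?_ * ?_
    rw [div_le_div_iff₀ (by positivity) (by positivity)]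
    linarith
  refine summable_of_sum_range_le (c := 4) (fun n => by have := quartCoeff_pos n; positivity)
    fun n => ?_
  refine (Finset.sum_le_sum fun i _ => hterm i).trans ?_
  rw [← Finset.mul_sum, Finset.sum_range_sub', halfCoeff_zero, quartCoeff_zero]
  have := div_pos (halfCoeff_pos n) (quartCoeff_pos n)
  linarith

theorem weightedSummable_catNeg : WeightedSummable catNeg :=
  weightedSummable_cat.of_abs_le fun n => by simp [cat, catNeg, abs_mul]

theorem quarterSum_cat : quarterSum cat = 2 := by
  have h := congrArg quarterSum cat_eq
  have hc := weightedSummable_cat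
  rw [quarterSum_add weightedSummable_one (weightedSummable_X.mul (hc.pow 2)),
    quarterSum_mul weightedSummable_X (hc.pow 2), quarterSum_pow hc, quarterSum_X,
    quarterSum_one] at h
  have : (quarterSum cat - 2) ^ 2 = 0 := by linear_combination -4 * h
  linarith [pow_eq_zero_iff (two_ne_zero) |>.1 this]

theorem quarterSum_catNeg : quarterSum catNeg = 2 * (√2 - 1) := by
  have h := congrArg quarterSum catNeg_eq
  have hc := weightedSummable_catNeg
  rw [quarterSum_sub weightedSummable_one (weightedSummable_X.mul (hc.pow 2)),
    quarterSum_mul weightedSummable_X (hc.pow 2), quarterSum_pow hc, quarterSum_X,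
    quarterSum_one] at h
  -- This bound by C(1/4) rules out the other root -2 - 2√2 of the quadratic.
  have h1 : |quarterSum catNeg| ≤ 2 := by
    rw [← quarterSum_cat]
    have hc' : Summable fun n => ‖coeff n catNeg * (1 / 4) ^ n‖ := hc.summable_abs
    have hn : ∀ n, ‖coeff n catNeg * (1 / 4) ^ n‖ = coeff n cat * (1 / 4) ^ n := fun n => by
      simp [cat, catNeg]
    have h2 := norm_tsum_le_tsum_norm hc'
    simp only [hn] at h2
    exact h2
  have h2 := Real.sq_sqrt (show (0 : ℝ) ≤ 2 by norm_num)
  have h3 : (quarterSum catNeg + 2 - 2 * √2) * (quarterSum catNeg + 2 + 2 * √2) = 0 := by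
    linear_combination 4 * h - 4 * h2
  have h4 : (0 : ℝ) < √2 := by positivity
  rcases mul_eq_zero.1 h3 with h5 | h5
  · linarith
  · linarith [(abs_le.1 h1).1]

theorem exists_totalGF_factor : ∃ d : ℝ⟦X⟧, WeightedSummable d ∧ quarterSum d ≠ 0 ∧
    totalGF = d * quartSeries := by
  obtain ⟨g, hg0, hg, hgb⟩ := exists_sqrt_inv_cat
  have hy : WeightedSummable (1 + X * cat) :=
    weightedSummable_one.add (weightedSummable_X.mul weightedSummable_cat)
  have hgw : WeightedSummable g := hy.of_abs_le hgb
  have hhw : WeightedSummable (rescale (-1 : ℝ) g) := hy.of_abs_le fun n => by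
    rw [coeff_rescale, abs_mul, abs_pow, abs_neg, abs_one, one_pow, one_mul]
    exact hgb n
  have hresc : rescale (-1 : ℝ) cat = catNeg := by
    ext n; simp [cat, catNeg]
  have hh : rescale (-1 : ℝ) g ^ 2 * catNeg = 1 := by
    rw [← hresc, ← map_pow, ← map_mul, hg, map_one]
  refine ⟨g * rescale (-1 : ℝ) g, hgw.mul hhw, ?_, totalGF_eq hg0 ?_ hg hh⟩
  · intro h0
    -- The factor d satisfies d² C(t) C(-t) = 1, so d(1/4) cannot vanish.
    have h1 : quarterSum ((g * rescale (-1 : ℝ) g) ^ 2 * (cat * catNeg)) = 1 := by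
      refine (congrArg quarterSum ?_).trans quarterSum_one
      linear_combination rescale (-1 : ℝ) g ^ 2 * catNeg * hg + hh
    rw [quarterSum_mul ((hgw.mul hhw).pow 2) (weightedSummable_cat.mul weightedSummable_catNeg),
      quarterSum_pow (hgw.mul hhw), h0] at h1
    norm_num at h1
  · rw [← coeff_zero_eq_constantCoeff_apply, coeff_rescale]
    simpa using hg0

theorem tendsto_coeff_mul_totalGF (hf : WeightedSummable f) :
    Tendsto (fun n => coeff n (f * totalGF) / coeff n totalGF) atTop (𝓝 (quarterSum f)) := by
  obtain ⟨d, hd, hd0, h⟩ := exists_totalGF_factor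
  have h1 := tendsto_coeff_mul_quartSeries (hf.mul hd)
  have h2 := tendsto_coeff_mul_quartSeries hd
  have h3 := h1.div h2 hd0
  rw [quarterSum_mul hf hd, mul_div_cancel_right₀ _ hd0] at h3
  refine h3.congr fun n => ?_
  have := quartCoeff_pos n
  rw [Pi.div_apply, h, ← mul_assoc]
  exact div_div_div_cancel_right₀ (by positivity) _ _

end SlitPlane

/-! ### Values at 1/4 and the two limits -/

namespace SlitPlane
open PowerSeries Finset.HasAntidiagonal Filter Topology

theorem sum_halfCoeff_mul (n : ℕ) :
    ∑ x ∈ antidiagonal n, halfCoeff x.1 * halfCoeff x.2 = 1 := by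
  have h1 : halfSeries ^ 2 = PowerSeries.mk fun _ => (1 : ℝ) := by
    have h2 := PowerSeries.mk_one_mul_one_sub_eq_one ℝ
    have h3 : halfSeries ^ 2 * (1 - X) * (PowerSeries.mk 1) = PowerSeries.mk 1 := by
      rw [halfSeries_sq, one_mul]
    calc halfSeries ^ 2 = halfSeries ^ 2 * (PowerSeries.mk 1 * (1 - X)) := by rw [h2, mul_one]
      _ = _ := by rw [← mul_assoc, mul_right_comm, h3]; rfl
  have h2 := congrArg (coeff n) h1
  rw [sq, coeff_mul, coeff_mk] at h2
  simpa [halfSeries] using h2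

theorem halfCoeff_le_one (n : ℕ) : halfCoeff n ≤ 1 := by
  induction n with
  | zero => rw [halfCoeff_zero]
  | succ n ih => exact (halfCoeff_succ_lt n).le.trans ih

theorem summable_norm_halfCoeff {x : ℝ} (hx : |x| < 1) :
    Summable fun n => ‖halfCoeff n * x ^ n‖ := by
  refine Summable.of_nonneg_of_le (fun n => norm_nonneg _) (fun n => ?_)
    (summable_geometric_of_lt_one (abs_nonneg x) hx)
  rw [norm_mul, norm_pow, Real.norm_eq_abs, Real.norm_eq_abs, abs_of_pos (halfCoeff_pos n)]
  exact mul_le_of_le_one_left (by positivity) (halfCoeff_le_one n)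

/-- The Cauchy square determines the sum F(x) up to sign, and positivity, not evident for x < 0,
selects the root: in (1 - y)F(y) = 1 - ∑ (h_n - h_{n+1}) y^(n+1) the differences are positive, so (1
- x)F(x) ≥ (1 - |x|)F(|x|) > 0. -/
theorem tsum_halfCoeff {x : ℝ} (hx : |x| < 1) :
    ∑' n, halfCoeff n * x ^ n = 1 / √(1 - x) := by
  have hx1 : 0 < 1 - x := by linarith [(abs_lt.1 hx).2]
  have hs {y : ℝ} (hy : |y| < 1) : Summable fun n => halfCoeff n * y ^ n :=
    (summable_norm_halfCoeff hy).of_norm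
  have hsq : (∑' n, halfCoeff n * x ^ n) ^ 2 * (1 - x) = 1 := by
    rw [sq, tsum_mul_tsum_eq_tsum_sum_antidiagonal_of_summable_norm (summable_norm_halfCoeff hx)
      (summable_norm_halfCoeff hx)]
    have h : ∀ n, ∑ kl ∈ antidiagonal n, halfCoeff kl.1 * x ^ kl.1 * (halfCoeff kl.2 * x ^ kl.2) =
        x ^ n := by
      intro n
      rw [← one_mul (x ^ n), ← sum_halfCoeff_mul n, Finset.sum_mul]
      refine Finset.sum_congr rfl fun kl hkl => ?_
      rw [← Finset.HasAntidiagonal.mem_antidiagonal.1 hkl, pow_add]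
      ring
    simp only [h]
    rw [tsum_geometric_of_abs_lt_one hx, inv_mul_cancel₀ hx1.ne']
  have hdiff {y : ℝ} (hy : |y| < 1) :
      HasSum (fun n => (halfCoeff n - halfCoeff (n + 1)) * y ^ (n + 1))
        (1 - (1 - y) * ∑' n, halfCoeff n * y ^ n) := by
    have h1 := (hs hy).hasSum.mul_left y
    have h2 := (hasSum_nat_add_iff' 1).2 (hs hy).hasSum
    rw [Finset.sum_range_one, halfCoeff_zero, pow_zero, mul_one] at h2
    have e1 : (fun n => (halfCoeff n - halfCoeff (n + 1)) * y ^ (n + 1)) = fun n =>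
        y * (halfCoeff n * y ^ n) - halfCoeff (n + 1) * y ^ (n + 1) := by
      funext n; rw [pow_succ]; ring
    have e2 : 1 - (1 - y) * ∑' n, halfCoeff n * y ^ n =
      y * ∑' n, halfCoeff n * y ^ n - (∑' n, halfCoeff n * y ^ n - 1) := by ring
    rw [e1, e2]
    exact h1.sub h2
  have hpos : 0 < ∑' n, halfCoeff n * x ^ n := by
    have hy : |(|x|)| < 1 := by rwa [abs_abs]
    have h0 : 0 < ∑' n, halfCoeff n * |x| ^ n :=
      (hs hy).tsum_pos (fun n => mul_nonneg (halfCoeff_pos n).le (by positivity)) 0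
        (by simp [halfCoeff_zero])
    have h1 := hasSum_le (fun n => ?_) (hdiff hx) (hdiff hy)
    · have h3 : 0 < (1 - |x|) * ∑' n, halfCoeff n * |x| ^ n := mul_pos (by linarith) h0
      have h4 : 0 < (1 - x) * ∑' n, halfCoeff n * x ^ n := by linarith
      exact pos_of_mul_pos_right h4 hx1.le
    · refine mul_le_mul_of_nonneg_left ?_ (by linarith [halfCoeff_succ_lt n])
      rw [← abs_pow]
      exact le_abs_self _
  rw [eq_div_iff (Real.sqrt_pos.2 hx1).ne']
  have h5 : ((∑' n, halfCoeff n * x ^ n) * √(1 - x)) ^ 2 = 1 ^ 2 := by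
    rw [mul_pow, Real.sq_sqrt hx1.le, hsq, one_pow]
  exact (pow_left_inj₀ (mul_pos hpos (Real.sqrt_pos.2 hx1)).le zero_le_one two_ne_zero).1 h5

theorem weightedSummable_slitGF (l : ℕ) : WeightedSummable (slitGF l) := by
  rw [slitGF_eq]
  exact weightedSummable_sum _ _ fun x _ => (weightedSummable_C _).mul
    (((weightedSummable_cat.sub weightedSummable_one).pow _).mul
      ((weightedSummable_one.sub weightedSummable_catNeg).pow _))

theorem slitS_eq_quarterSum (l : ℕ) : slitS l 0 (1 / 4) = quarterSum (slitGF l) := by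
  rw [slitS, quarterSum]
  exact tsum_congr fun n => by rw [walkCount_eq, slitGF]

theorem slitS_eq (l : ℕ) : slitS l 0 (1 / 4) =
    ∑ x ∈ antidiagonal l, halfCoeff x.1 * halfCoeff x.2 * ((√2 - 1) ^ 2) ^ x.2 := by
  have h1 := weightedSummable_cat.sub weightedSummable_one
  have h2 := weightedSummable_one.sub weightedSummable_catNeg
  rw [slitS_eq_quarterSum, slitGF_eq, quarterSum_sum _ _ fun x _ => (weightedSummable_C _).mul
    ((h1.pow _).mul (h2.pow _))]
  refine Finset.sum_congr rfl fun x _ => ?_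
  rw [quarterSum_mul (weightedSummable_C _) ((h1.pow _).mul (h2.pow _)),
    quarterSum_mul (h1.pow _) (h2.pow _), quarterSum_C, quarterSum_pow h1, quarterSum_pow h2,
    quarterSum_sub weightedSummable_cat weightedSummable_one,
    quarterSum_sub weightedSummable_one weightedSummable_catNeg, quarterSum_cat,
    quarterSum_catNeg, quarterSum_one]
  have h3 : 1 - 2 * (√2 - 1) = (√2 - 1) ^ 2 := by
    linear_combination -Real.sq_sqrt (show (0 : ℝ) ≤ 2 by norm_num)
  rw [h3]
  norm_num

theorem sqrt_two_bounds : 1.41421 < √2 ∧ √2 < 1.414214 :=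
  ⟨Real.lt_sqrt_of_sq_lt (by norm_num), (Real.sqrt_lt' (by norm_num)).2 (by norm_num)⟩

theorem slitS_pos (l : ℕ) : 0 < slitS l 0 (1 / 4) := by
  rw [slitS_eq]
  have h : 0 < √2 - 1 := by linarith [sqrt_two_bounds.1]
  refine Finset.sum_pos (fun x _ => ?_) ⟨(0, l), by simp⟩
  have := halfCoeff_pos x.1
  have := halfCoeff_pos x.2
  positivity

theorem hasSum_slitS {x : ℝ} (hx : |x| < 1) : HasSum (fun l : ℕ => slitS l 0 (1 / 4) * x ^ l)
    (1 / √((1 - x) * (1 - x * (√2 - 1) ^ 2))) := by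
  obtain ⟨hl, hu⟩ := sqrt_two_bounds
  set V := (√2 - 1) ^ 2 with hV
  have hV0 : 0 ≤ V := sq_nonneg _
  have hV1 : V < 1 := by rw [hV]; nlinarith
  have hy : |x * V| < 1 := by
    rw [abs_mul, abs_of_nonneg hV0]
    exact mul_lt_one_of_nonneg_of_lt_one_left (abs_nonneg _) hx hV1.le
  have h1 := summable_norm_halfCoeff hx
  have h2 := summable_norm_halfCoeff hy
  have e : ∀ l : ℕ, slitS l 0 (1 / 4) * x ^ l = ∑ kl ∈ antidiagonal l,
      halfCoeff kl.1 * x ^ kl.1 * (halfCoeff kl.2 * (x * V) ^ kl.2) := by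
    intro l
    rw [slitS_eq, Finset.sum_mul]
    refine Finset.sum_congr rfl fun kl hkl => ?_
    rw [← Finset.HasAntidiagonal.mem_antidiagonal.1 hkl, pow_add, mul_pow]
    ring
  have h3 := (summable_norm_sum_mul_antidiagonal_of_summable_norm h1 h2).of_norm.hasSum
  rw [← tsum_mul_tsum_eq_tsum_sum_antidiagonal_of_summable_norm h1 h2, tsum_halfCoeff hx,
    tsum_halfCoeff hy, one_div_mul_one_div,
    ← Real.sqrt_mul (by linarith [(abs_lt.1 hx).2])] at h3
  simpa only [e] using h3

/-- For V = 1 the convolution sums all equal 1. Subtracting V^(n+1) times that identity turns the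
difference into a sum of products of positive factors h_j, h_{n-j} - h_{n+1-j} and V^j - V^(n+1),
where h is `halfCoeff` and 0 < V < 1. -/
theorem slitS_succ_lt (n : ℕ) : slitS (n + 1 : ℕ) 0 (1 / 4) < slitS n 0 (1 / 4) := by
  obtain ⟨hl, hu⟩ := sqrt_two_bounds
  have hV0 : 0 < (√2 - 1) ^ 2 := by
    have : 0 < √2 - 1 := by linarith
    positivity
  have hV1 : (√2 - 1) ^ 2 < 1 := by nlinarith
  rw [slitS_eq, slitS_eq]
  generalize (√2 - 1) ^ 2 = V at hV0 hV1
  have hF (V : ℝ) (m : ℕ) : ∑ x ∈ antidiagonal m, halfCoeff x.1 * halfCoeff x.2 * V ^ x.2 =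
      ∑ j ∈ Finset.range (m + 1), halfCoeff j * halfCoeff (m - j) * V ^ j := by
    rw [← Finset.Nat.sum_antidiagonal_eq_sum_range_succ
      (fun i j => halfCoeff i * halfCoeff j * V ^ i), ← Finset.Nat.sum_antidiagonal_swap]
    exact Finset.sum_congr rfl fun x _ => by rw [Prod.fst_swap, Prod.snd_swap, mul_comm (halfCoeff _)]
  have h1 (m : ℕ) : ∑ j ∈ Finset.range (m + 1), halfCoeff j * halfCoeff (m - j) = 1 := by
    have := hF 1 m
    simp only [one_pow, mul_one] at this
    rw [← this, sum_halfCoeff_mul]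
  rw [hF, hF, Finset.sum_range_succ _ (n + 1)]
  have h2 := h1 (n + 1)
  rw [Finset.sum_range_succ, ← h1 n, Nat.sub_self, halfCoeff_zero, mul_one] at h2
  rw [Nat.sub_self, halfCoeff_zero, mul_one, ← sub_pos]
  have h3 : ∑ j ∈ Finset.range (n + 1), halfCoeff j * halfCoeff (n - j) * V ^ j -
      (∑ j ∈ Finset.range (n + 1), halfCoeff j * halfCoeff (n + 1 - j) * V ^ j +
        halfCoeff (n + 1) * V ^ (n + 1)) =
      ∑ j ∈ Finset.range (n + 1),
        halfCoeff j * (halfCoeff (n - j) - halfCoeff (n + 1 - j)) * (V ^ j - V ^ (n + 1)) := by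
    have h4 : halfCoeff (n + 1) = ∑ j ∈ Finset.range (n + 1), halfCoeff j * halfCoeff (n - j) -
        ∑ j ∈ Finset.range (n + 1), halfCoeff j * halfCoeff (n + 1 - j) := by linarith
    rw [h4, sub_mul, Finset.sum_mul, Finset.sum_mul, ← Finset.sum_sub_distrib,
      ← Finset.sum_add_distrib, ← Finset.sum_sub_distrib]
    exact Finset.sum_congr rfl fun j _ => by ring
  rw [h3]
  refine Finset.sum_pos (fun j hj => ?_) ⟨0, by simp⟩
  have hj' : j < n + 1 := Finset.mem_range.1 hj
  have h5 : halfCoeff (n + 1 - j) < halfCoeff (n - j) := by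
    rw [Nat.succ_sub (by omega)]
    exact halfCoeff_succ_lt _
  have h6 : V ^ (n + 1) < V ^ j := pow_lt_pow_right_of_lt_one₀ hV0 hV1 hj'
  exact mul_pos (mul_pos (halfCoeff_pos j) (sub_pos.2 h5)) (sub_pos.2 h6)

theorem strictAnti_slitS : StrictAnti fun l : ℕ => slitS l 0 (1 / 4) :=
  strictAnti_nat_of_succ_lt slitS_succ_lt

theorem slitP_lt_one {k : ℕ} (hk : 0 < k) : slitP k < 1 := by
  have hne : (Finset.range k).Nonempty := ⟨0, by simpa using hk⟩
  have hB : 0 < ∑ l ∈ Finset.range k, slitS l 0 (1 / 4) ^ 2 :=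
    Finset.sum_pos (fun l _ => pow_pos (slitS_pos l) 2) hne
  rw [slitP, ← mul_div_assoc, div_lt_one hB, Finset.mul_sum]
  refine Finset.sum_lt_sum_of_nonempty hne fun l hl => ?_
  rw [sq]
  exact mul_lt_mul_of_pos_right (strictAnti_slitS (Finset.mem_range.1 hl)) (slitS_pos l)

theorem weightedSummable_loopGF : WeightedSummable loopGF := by
  rw [loopGF_eq]
  exact weightedSummable_cat.mul weightedSummable_catNeg

theorem quarterSum_loopGF : quarterSum loopGF = 4 * (√2 - 1) := by
  rw [loopGF_eq, quarterSum_mul weightedSummable_cat weightedSummable_catNeg, quarterSum_cat,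
    quarterSum_catNeg]
  ring

theorem natCast_notMem_halfAxis {k : ℕ} (hk : 0 < k) : ((k : ℤ), (0 : ℤ)) ∉ halfAxis := by
  intro h
  have : (k : ℤ) ≤ 0 := h.1
  omega

theorem tendsto_averageVisits {k : ℕ} (hk : 0 < k) :
    Tendsto (averageVisits ((k : ℤ), 0)) atTop (𝓝 (slitV k)) := by
  have hS := weightedSummable_slitGF
  have hsum := weightedSummable_sum (Finset.range k) slitGF fun l _ => hS l
  have h := tendsto_coeff_mul_totalGF ((weightedSummable_loopGF.mul (hS k)).mul hsum)
  rw [quarterSum_mul (weightedSummable_loopGF.mul (hS k)) hsum,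
    quarterSum_mul weightedSummable_loopGF (hS k), quarterSum_sum _ _ fun l _ => hS l,
    quarterSum_loopGF] at h
  simp only [← slitS_eq_quarterSum] at h
  refine h.congr fun n => ?_
  rw [averageVisits_eq, totalGF_from hk, ← slitGF]
  congr 2
  ring

theorem tendsto_visitProportion {k : ℕ} (hk : 0 < k) :
    Tendsto (visitProportion ((k : ℤ), 0)) atTop (𝓝 (slitP k)) := by
  have hz := natCast_notMem_halfAxis hk
  have hS := weightedSummable_slitGF
  have hE := weightedSummable_loopGF
  have hsum := weightedSummable_sum (Finset.range k) slitGF fun l _ => hS l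
  have hsq := weightedSummable_sum (Finset.range k) (fun l => slitGF l ^ 2)
    fun l _ => (hS l).pow 2
  have hD : WeightedSummable (green halfAxis (k, 0) (k, 0)) := by
    rw [green_self hk]
    exact hE.mul hsq
  -- Returns are dominated by loops, so 1 - `returnGF`, the inverse of the loop series at (k,0),
  -- also lies in the weighted algebra and its value at 1/4 is the inverse value.
  have hr : WeightedSummable (returnGF halfAxis (k, 0)) := hD.of_abs_le fun n => by
    rw [abs_of_nonneg (returnGF_coeff_nonneg n _)]
    exact returnGF_coeff_le hz n
  have hr1 := weightedSummable_one.sub hr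
  have h := tendsto_coeff_mul_totalGF (((hS k).mul (hr1.mul hE)).mul hsum)
  have hDr := green_mul_one_sub_returnGF hz
  have e := congrArg quarterSum hDr
  rw [green_self hk, quarterSum_mul (hE.mul hsq) hr1, quarterSum_mul hE hsq, quarterSum_one] at e
  have e2 : quarterSum (1 - returnGF halfAxis (k, 0)) * quarterSum loopGF =
      1 / quarterSum (∑ l ∈ Finset.range k, slitGF l ^ 2) := by
    rw [eq_div_iff]
    · linarith
    · intro h0
      rw [h0] at e
      simp at e
  rw [quarterSum_mul ((hS k).mul (hr1.mul hE)) hsum, quarterSum_mul (hS k) (hr1.mul hE),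
    quarterSum_mul hr1 hE, e2, quarterSum_sum _ _ fun l _ => hS l,
    quarterSum_sum _ _ fun l _ => (hS l).pow 2] at h
  simp only [quarterSum_pow (hS _), ← slitS_eq_quarterSum] at h
  have e3 : slitP k = slitS k 0 (1 / 4) * (1 / ∑ l ∈ Finset.range k, slitS l 0 (1 / 4) ^ 2) *
      ∑ l ∈ Finset.range k, slitS l 0 (1 / 4) := by
    rw [slitP]
    ring
  rw [e3]
  refine h.congr fun n => ?_
  have h1 := avoidGF_insert_self (f := 1) hz
  rw [totalGF_from hk] at h1
  rw [visitProportion_eq hz, ← slitGF]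
  congr 2
  linear_combination slitGF k * (1 - returnGF halfAxis (k, 0)) * h1 +
    slitGF k * avoidGF (insert ((k : ℤ), (0 : ℤ)) halfAxis) 1 ((k : ℤ), (0 : ℤ)) * hDr

theorem slitS_zero : slitS 0 0 (1 / 4) = 1 := by
  have := slitS_eq 0
  simpa [halfCoeff_zero] using this

theorem slitS_one : slitS 1 0 (1 / 4) = 2 - √2 := by
  have := slitS_eq 1
  rw [Finset.Nat.sum_antidiagonal_eq_sum_range_succ_mk] at this
  norm_num [Finset.sum_range_succ, halfCoeff_succ, halfCoeff_zero] at this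
  rw [this]
  linear_combination (1 / 2) * Real.sq_sqrt (show (0 : ℝ) ≤ 2 by norm_num)

theorem slitS_two : slitS 2 0 (1 / 4) = 15 / 2 - 5 * √2 := by
  have := slitS_eq 2
  rw [Finset.Nat.sum_antidiagonal_eq_sum_range_succ_mk] at this
  norm_num [Finset.sum_range_succ, halfCoeff_succ, halfCoeff_zero] at this
  rw [this]
  linear_combination (3 / 8 * √2 ^ 2 - 3 / 2 * √2 + 13 / 4) *
    Real.sq_sqrt (show (0 : ℝ) ≤ 2 by norm_num)

theorem slitP_one : slitP 1 = 2 - √2 := by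
  have h0 := slitS_zero
  have h1 := slitS_one
  simp only [slitP, Finset.sum_range_one]
  push_cast
  rw [h0, h1]
  norm_num

theorem slitP_two : slitP 2 = 5 / 34 * (19 - 11 * √2) := by
  have h0 := slitS_zero
  have h1 := slitS_one
  have h2 := slitS_two
  simp only [slitP, Finset.sum_range_succ, Finset.sum_range_zero, zero_add]
  push_cast
  rw [h0, h1, h2, ← mul_div_assoc, div_eq_iff (by positivity)]
  linear_combination (55 / 34 * √2 - 5 / 34 * 29 ) * Real.sq_sqrt (show (0 : ℝ) ≤ 2 by norm_num)

theorem slitV_one : slitV 1 = 4 * (3 * √2 - 4) := by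
  have h0 := slitS_zero
  have h1 := slitS_one
  simp only [slitV, Finset.sum_range_one]
  push_cast
  rw [h0, h1]
  linear_combination -4 * Real.sq_sqrt (show (0 : ℝ) ≤ 2 by norm_num)

theorem slitV_two : slitV 2 = 10 * (22 * √2 - 31) := by
  have h0 := slitS_zero
  have h1 := slitS_one
  have h2 := slitS_two
  simp only [slitV, Finset.sum_range_succ, Finset.sum_range_zero, zero_add]
  push_cast
  rw [h0, h1, h2]
  linear_combination (20 * √2 - 110) * Real.sq_sqrt (show (0 : ℝ) ≤ 2 by norm_num)

end SlitPlane

theorem mainTheorem7 :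
    -- the series `S_{ℓ,0}(1/4)` converge
    (∀ l : ℕ, Summable fun n : ℕ => (walkCount l 0 n : ℝ) * (1 / 4 : ℝ) ^ n) ∧
    -- limiting visit probability and limiting mean number of visits
    (∀ k : ℕ, 0 < k →
      Filter.Tendsto (visitProportion ((k : ℤ), 0)) Filter.atTop (nhds (slitP k)) ∧
      slitP k < 1 ∧
      Filter.Tendsto (averageVisits ((k : ℤ), 0)) Filter.atTop (nhds (slitV k))) ∧
    -- the series `S_0(x; 1/4)`
    (∀ x : ℝ, |x| < 1 →
      HasSum (fun l : ℕ => slitS l 0 (1 / 4) * x ^ l)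
        (1 / √((1 - x) * (1 - x * (√2 - 1) ^ 2)))) ∧
    -- the values for `k = 1, 2`
    (slitP 1 = 2 - √2 ∧ |slitP 1 - 0.586| < 0.0005) ∧
    (slitP 2 = 5 / 34 * (19 - 11 * √2) ∧ |slitP 2 - 0.506| < 0.0005) ∧
    slitP 2 < slitP 1 ∧
    (slitV 1 = 4 * (3 * √2 - 4) ∧ |slitV 1 - 0.97| < 0.005) ∧
    (slitV 2 = 10 * (22 * √2 - 31) ∧ |slitV 2 - 1.13| < 0.005) ∧
    slitV 1 < slitV 2 := by
  obtain ⟨hl, hu⟩ := SlitPlane.sqrt_two_bounds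
  have p1 := SlitPlane.slitP_one
  have p2 := SlitPlane.slitP_two
  have v1 := SlitPlane.slitV_one
  have v2 := SlitPlane.slitV_two
  refine ⟨fun l => ?_, fun k hk => ⟨SlitPlane.tendsto_visitProportion hk,
    SlitPlane.slitP_lt_one hk, SlitPlane.tendsto_averageVisits hk⟩,
    fun x hx => SlitPlane.hasSum_slitS hx, ⟨p1, ?_⟩, ⟨p2, ?_⟩, ?_, ⟨v1, ?_⟩, ⟨v2, ?_⟩, ?_⟩
  · have h := (SlitPlane.weightedSummable_slitGF l).summable
    simpa only [SlitPlane.walkCount_eq, SlitPlane.slitGF] using h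
  · rw [p1, abs_lt]; constructor <;> linarith
  · rw [p2, abs_lt]; constructor <;> linarith
  · rw [p1, p2]; linarith
  · rw [v1, abs_lt]; constructor <;> linarith
  · rw [v2, abs_lt]; constructor <;> linarith
  · rw [v1, v2]; linarith
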